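/- Let $\mathcal V=(V,\otimes,I)$ be a monoidal category with equalizers and coequalizers, such that $\otimes$ preserves coequalizers in both variables (associativity and unit isomorphisms are suppressed below). Let $A=(A,e_A,m_A)$ be an algebra and $C=(C,\varepsilon_C,\delta_C)$ a coalgebra in $\mathcal V$. An entwining structure $(C,A,\lambda)$ is a morphism $\lambda:C\otimes A\to A\otimes C$ such that $-\otimes\lambda$ is a mixed distributive law from the monad $-\otimes A$ to the comonad $-\otimes C$, i.e. $$\lambda(C\otimes e_A)=e_A\otimes C,\qquad \lambda(C\otimes m_A)=(m_A\otimes C)(A\otimes\lambda)(\lambda\otimes A),$$ $$(A\otimes\varepsilon_C)\lambda=\varepsilon_C\otimes A,\qquad (A\otimes\delta_C)\lambda=(\lambda\otimes C)(C\otimes\lambda)(\delta_C\otimes A).$$ Let $g:I\to C$ be a group-like element, i.e. $\varepsilon_C g=1_I$ and $\delta_C g=g\otimes g$. Put $g_A=\lambda(g\otimes A):A\to A\otimes C$, and let $i_A:A^C\to A$ be the equalizer of $g_A$ and $A\otimes g$; it is a morphism of algebras for a unique algebra structure on $A^C$. Write $\mathcal V_A$ for the category of right $A$-modules, and $\mathcal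 V^C_A(\lambda)$ for the category of entwined modules: objects $(M,\xi,\nu)$ with $(M,\xi:M\otimes A\to M)$ a right $A$-module and $(M,\nu:M\to M\otimes C)$ a right $C$-comodule such that $\nu\,\xi=(\xi\otimes C)(M\otimes\lambda)(\nu\otimes A)$; its morphisms are the morphisms of right modules that are also morphisms of comodules. Let $$F:\mathcal V_{A^C}\to\mathcal V_A,\quad F(X)=(X\otimes_{A^C}A,\ X\otimes_{A^C}m_A),\qquad \bar F:\mathcal V_{A^C}\to\mathcal V^C_A(\lambda),\quad \bar F(X)=(X\otimes_{A^C}A,\ X\otimes_{A^C}m_A,\ X\otimes_{A^C}g_A).$$ An $A$-coring is a coalgebra in the category of $A$-$A$-bimodules with tensor product $\otimes_A$. The object $A\otimes_{A^C}A$ is an $A$-coring with counit induced by $m_A$ and comultiplication $A\otimes_{A^C}i_A\otimes_{A^C}A$; and $A\otimes C$, with left action $m_A\otimes C$ and right action $(m_A\otimes C)(A\otimes\lambda)$, is an $A$-coring with counit $A\otimes\varepsilon_C$ and comultiplication $A\otimes\delta_C$ (using $(A\otimes C)\otimes_A(A\otimes C)\simeq A\otimes C\otimes C$). Let $\mathrm{can}:A\otimes_{A^C}A\to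 A\otimes C$ be the morphism of $A$-corings induced by $(m_A\otimes C)(A\otimes g_A)$; $A$ is called $(C,g)$-Galois if $\mathrm{can}$ is an isomorphism of $A$-corings. A functor is comonadic if it has a right adjoint and the comparison functor to the coalgebras of the resulting comonad is an equivalence. **Theorem.** The functor $\bar F:\mathcal V_{A^C}\to\mathcal V^C_A(\lambda)$ is an equivalence of categories if and only if $A$ is $(C,g)$-Galois and the functor $F=-\otimes_{A^C}A$ is comonadic. -/

import Mathlib

open CategoryTheory Limits MonoidalCategory
open scoped MonObj ComonObj

universe v u

set_option linter.unusedSectionVars false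

namespace Entwine

section RelTensor

variable {V : Type u} [Category.{v} V] [MonoidalCategory V] [HasCoequalizers V]

/-- The tensor product `X ⊗_B Y` over `B` of a right action `r` of `B` on `X` and a left action
`l` of `B` on `Y`: the coequalizer of `X ⊗ B ⊗ Y ⇉ X ⊗ Y`. -/
noncomputable def relTensor {X B Y : V} (r : X ⊗ B ⟶ X) (l : B ⊗ Y ⟶ Y) : V :=
  coequalizer (r ▷ Y) ((α_ X B Y).hom ≫ X ◁ l)

namespace relTensor

variable {X B Y : V} (r : X ⊗ B ⟶ X) (l : B ⊗ Y ⟶ Y)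

/-- The canonical projection `X ⊗ Y ⟶ X ⊗_B Y`. -/
noncomputable def proj : X ⊗ Y ⟶ relTensor r l :=
  coequalizer.π (r ▷ Y) ((α_ X B Y).hom ≫ X ◁ l)

theorem condition : r ▷ Y ≫ proj r l = (α_ X B Y).hom ≫ X ◁ l ≫ proj r l := by
  rw [← Category.assoc]
  exact coequalizer.condition _ _

variable {r l} in
/-- A balanced morphism on `X ⊗ Y` descends to `X ⊗_B Y`. -/
noncomputable def desc {Z : V} (f : X ⊗ Y ⟶ Z)
    (h : r ▷ Y ≫ f = (α_ X B Y).hom ≫ X ◁ l ≫ f) : relTensor r l ⟶ Z :=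
  coequalizer.desc f (by rw [h, Category.assoc])

theorem proj_desc {Z : V} (f : X ⊗ Y ⟶ Z)
    (h : r ▷ Y ≫ f = (α_ X B Y).hom ≫ X ◁ l ≫ f) : proj r l ≫ desc f h = f :=
  coequalizer.π_desc _ _

instance : Epi (proj r l) := coequalizer.π_epi

instance epi_proj_whiskerRight
    [∀ W : V, PreservesColimitsOfShape WalkingParallelPair (tensorRight W)] (W : V) :
    Epi (proj r l ▷ W) :=
  inferInstanceAs (Epi ((tensorRight W).map (coequalizer.π (r ▷ Y) ((α_ X B Y).hom ≫ X ◁ l))))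

instance epi_whiskerLeft_proj
    [∀ W : V, PreservesColimitsOfShape WalkingParallelPair (tensorLeft W)] (W : V) :
    Epi (W ◁ proj r l) :=
  inferInstanceAs (Epi ((tensorLeft W).map (coequalizer.π (r ▷ Y) ((α_ X B Y).hom ≫ X ◁ l))))

instance epi_proj_whiskerRight_whiskerRight
    [∀ W : V, PreservesColimitsOfShape WalkingParallelPair (tensorRight W)] (W W' : V) :
    Epi (proj r l ▷ W ▷ W') :=
  inferInstanceAs (Epi ((tensorRight W ⋙ tensorRight W').map
    (coequalizer.π (r ▷ Y) ((α_ X B Y).hom ≫ X ◁ l))))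

instance epi_whiskerLeft_proj_whiskerRight
    [∀ W : V, PreservesColimitsOfShape WalkingParallelPair (tensorLeft W)]
    [∀ W : V, PreservesColimitsOfShape WalkingParallelPair (tensorRight W)] (W W' : V) :
    Epi ((W ◁ proj r l) ▷ W') :=
  inferInstanceAs (Epi ((tensorLeft W ⋙ tensorRight W').map
    (coequalizer.π (r ▷ Y) ((α_ X B Y).hom ≫ X ◁ l))))

variable {r l} in
/-- A balanced morphism on `(X ⊗ Y) ⊗ W` descends to `(X ⊗_B Y) ⊗ W`. -/
noncomputable def descRight
    [∀ W : V, PreservesColimitsOfShape WalkingParallelPair (tensorRight W)]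
    {W Z : V} (f : (X ⊗ Y) ⊗ W ⟶ Z)
    (h : (r ▷ Y) ▷ W ≫ f = ((α_ X B Y).hom ≫ X ◁ l) ▷ W ≫ f) : relTensor r l ⊗ W ⟶ Z :=
  (isColimitOfHasCoequalizerOfPreservesColimit (tensorRight W) (r ▷ Y)
    ((α_ X B Y).hom ≫ X ◁ l)).desc (Cofork.ofπ f h)

theorem proj_descRight
    [∀ W : V, PreservesColimitsOfShape WalkingParallelPair (tensorRight W)]
    {W Z : V} (f : (X ⊗ Y) ⊗ W ⟶ Z)
    (h : (r ▷ Y) ▷ W ≫ f = ((α_ X B Y).hom ≫ X ◁ l) ▷ W ≫ f) :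
    proj r l ▷ W ≫ descRight f h = f :=
  (isColimitOfHasCoequalizerOfPreservesColimit (tensorRight W) (r ▷ Y)
    ((α_ X B Y).hom ≫ X ◁ l)).fac (Cofork.ofπ f h) WalkingParallelPair.one

variable {r l} in
/-- A balanced morphism on `W ⊗ (X ⊗ Y)` descends to `W ⊗ (X ⊗_B Y)`. -/
noncomputable def descLeft
    [∀ W : V, PreservesColimitsOfShape WalkingParallelPair (tensorLeft W)]
    {W Z : V} (f : W ⊗ (X ⊗ Y) ⟶ Z)
    (h : W ◁ (r ▷ Y) ≫ f = W ◁ ((α_ X B Y).hom ≫ X ◁ l) ≫ f) : W ⊗ relTensor r l ⟶ Z :=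
  (isColimitOfHasCoequalizerOfPreservesColimit (tensorLeft W) (r ▷ Y)
    ((α_ X B Y).hom ≫ X ◁ l)).desc (Cofork.ofπ f h)

theorem proj_descLeft
    [∀ W : V, PreservesColimitsOfShape WalkingParallelPair (tensorLeft W)]
    {W Z : V} (f : W ⊗ (X ⊗ Y) ⟶ Z)
    (h : W ◁ (r ▷ Y) ≫ f = W ◁ ((α_ X B Y).hom ≫ X ◁ l) ≫ f) :
    W ◁ proj r l ≫ descLeft f h = f :=
  (isColimitOfHasCoequalizerOfPreservesColimit (tensorLeft W) (r ▷ Y)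
    ((α_ X B Y).hom ≫ X ◁ l)).fac (Cofork.ofπ f h) WalkingParallelPair.one

variable {r l} in
/-- The morphism `f ⊗_B g : X ⊗_B Y ⟶ X' ⊗_B Y'` for linear `f` and `g`. -/
noncomputable def map {X' Y' : V} {r' : X' ⊗ B ⟶ X'} {l' : B ⊗ Y' ⟶ Y'} (f : X ⟶ X') (g : Y ⟶ Y')
    (hf : r ≫ f = f ▷ B ≫ r') (hg : l ≫ g = B ◁ g ≫ l') : relTensor r l ⟶ relTensor r' l' :=
  desc (f ▷ Y ≫ X' ◁ g ≫ proj r' l') (by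
    have e1 : r ▷ Y ≫ f ▷ Y ≫ X' ◁ g ≫ proj r' l' =
        f ▷ B ▷ Y ≫ (X' ⊗ B) ◁ g ≫ r' ▷ Y' ≫ proj r' l' := by
      rw [← comp_whiskerRight_assoc, hf, comp_whiskerRight_assoc, whisker_exchange_assoc]
    have e2 : X' ◁ l ≫ X' ◁ g = X' ◁ B ◁ g ≫ X' ◁ l' := by
      rw [← MonoidalCategory.whiskerLeft_comp, hg, MonoidalCategory.whiskerLeft_comp]
    rw [e1, condition, whisker_exchange_assoc, reassoc_of% e2]
    simp)

theorem proj_map {X' Y' : V} {r' : X' ⊗ B ⟶ X'} {l' : B ⊗ Y' ⟶ Y'} (f : X ⟶ X') (g : Y ⟶ Y')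
    (hf : r ≫ f = f ▷ B ≫ r') (hg : l ≫ g = B ◁ g ≫ l') :
    proj r l ≫ map f g hf hg = f ▷ Y ≫ X' ◁ g ≫ proj r' l' :=
  proj_desc _ _ _ _

section actRight

variable [∀ W : V, PreservesColimitsOfShape WalkingParallelPair (tensorRight W)]

variable {l} in
/-- The right action on `X ⊗_B Y` induced by a right action on `Y`. -/
noncomputable def actRight {D : V} (s : Y ⊗ D ⟶ Y)
    (hs : l ▷ D ≫ s = (α_ B Y D).hom ≫ B ◁ s ≫ l) : relTensor r l ⊗ D ⟶ relTensor r l :=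
  descRight ((α_ X Y D).hom ≫ X ◁ s ≫ proj r l) (by
    have e2 : X ◁ l ▷ D ≫ X ◁ s = X ◁ (α_ B Y D).hom ≫ X ◁ B ◁ s ≫ X ◁ l := by
      rw [← MonoidalCategory.whiskerLeft_comp, hs]; simp
    simp only [comp_whiskerRight, whisker_assoc, Category.assoc, Iso.inv_hom_id_assoc,
      associator_naturality_left_assoc]
    rw [reassoc_of% e2, ← whisker_exchange_assoc, condition]
    simp)

theorem proj_actRight {D : V} (s : Y ⊗ D ⟶ Y)
    (hs : l ▷ D ≫ s = (α_ B Y D).hom ≫ B ◁ s ≫ l) :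
    proj r l ▷ D ≫ actRight r s hs = (α_ X Y D).hom ≫ X ◁ s ≫ proj r l :=
  proj_descRight _ _ _ _

end actRight

section actLeft

variable [∀ W : V, PreservesColimitsOfShape WalkingParallelPair (tensorLeft W)]

variable {r} in
/-- The left action on `X ⊗_B Y` induced by a left action on `X`. -/
noncomputable def actLeft {D : V} (s : D ⊗ X ⟶ X)
    (hs : s ▷ B ≫ r = (α_ D X B).hom ≫ D ◁ r ≫ s) : D ⊗ relTensor r l ⟶ relTensor r l :=
  descLeft ((α_ D X Y).inv ≫ s ▷ Y ≫ proj r l) (by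
    have e2 : D ◁ r ▷ Y ≫ (α_ D X Y).inv ≫ s ▷ Y =
        D ◁ (α_ X B Y).hom ≫ (α_ D X (B ⊗ Y)).inv ≫ (α_ (D ⊗ X) B Y).inv ≫
          s ▷ B ▷ Y ≫ r ▷ Y := by
      rw [← comp_whiskerRight, hs]; simp
    rw [reassoc_of% e2, condition]
    simp only [MonoidalCategory.whiskerLeft_comp, Category.assoc]
    rw [associator_naturality_left_assoc, ← whisker_exchange_assoc]
    simp)

theorem proj_actLeft {D : V} (s : D ⊗ X ⟶ X)
    (hs : s ▷ B ≫ r = (α_ D X B).hom ≫ D ◁ r ≫ s) :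
    D ◁ proj r l ≫ actLeft l s hs = (α_ D X Y).inv ≫ s ▷ Y ≫ proj r l :=
  proj_descLeft _ _ _ _

end actLeft

end relTensor

end RelTensor

section Modules

variable {V : Type u} [Category.{v} V] [MonoidalCategory V]

/-- A right module over an algebra (monoid object) `A`. -/
structure RightModule (A : Mon V) where
  X : V
  act : X ⊗ A.X ⟶ X
  act_one : X ◁ η[A.X] ≫ act = (ρ_ X).hom
  act_mul : X ◁ μ[A.X] ≫ act = (α_ X A.X A.X).inv ≫ act ▷ A.X ≫ act

namespace RightModule

variable {A B : Mon V}

/-- A morphism of right modules. -/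
@[ext]
structure Hom (M N : RightModule A) where
  hom : M.X ⟶ N.X
  act_hom : M.act ≫ hom = hom ▷ A.X ≫ N.act

instance : Category (RightModule A) where
  Hom M N := Hom M N
  id M := ⟨𝟙 M.X, by simp⟩
  comp {M N P} f g := ⟨f.hom ≫ g.hom, by
    rw [← Category.assoc, f.act_hom, Category.assoc, g.act_hom]; simp⟩

@[ext]
theorem hom_ext {M N : RightModule A} (f g : M ⟶ N) (h : f.hom = g.hom) : f = g :=
  Hom.ext h

@[simp] theorem id_hom (M : RightModule A) : Hom.hom (𝟙 M) = 𝟙 M.X := rfl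

@[simp] theorem comp_hom {M N P : RightModule A} (f : M ⟶ N) (g : N ⟶ P) :
    Hom.hom (f ≫ g) = f.hom ≫ g.hom := rfl

section

variable [HasCoequalizers V]
  [∀ W : V, PreservesColimitsOfShape WalkingParallelPair (tensorRight W)]

/-- The right `A`-module `M ⊗_B Q`, for a right `B`-module `M` and a `B`-`A`-bimodule `Q`. -/
noncomputable def tensor (M : RightModule B) (Q : Bimod B A) : RightModule A where
  X := relTensor M.act Q.actLeft
  act := relTensor.actRight M.act Q.actRight Q.middle_assoc
  act_one := by
    rw [← cancel_epi (relTensor.proj _ _ ▷ _), ← whisker_exchange_assoc, relTensor.proj_actRight]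
    simp only [tensor_whiskerLeft, Category.assoc, Iso.inv_hom_id_assoc]
    rw [← MonoidalCategory.whiskerLeft_comp_assoc, Q.actRight_one]
    simp
  act_mul := by
    rw [← cancel_epi (relTensor.proj _ _ ▷ _), ← whisker_exchange_assoc, relTensor.proj_actRight]
    simp only [tensor_whiskerLeft, Category.assoc, Iso.inv_hom_id_assoc]
    rw [← MonoidalCategory.whiskerLeft_comp_assoc, Q.right_assoc]
    rw [associator_inv_naturality_left_assoc, ← comp_whiskerRight_assoc, relTensor.proj_actRight]
    simp only [comp_whiskerRight, Category.assoc, relTensor.proj_actRight]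
    simp

/-- The canonical projection `M ⊗ Q ⟶ M ⊗_B Q`. -/
noncomputable def tensorProj (M : RightModule B) (Q : Bimod B A) : M.X ⊗ Q.X ⟶ (M.tensor Q).X :=
  relTensor.proj M.act Q.actLeft

instance (M : RightModule B) (Q : Bimod B A) : Epi (tensorProj M Q) :=
  inferInstanceAs (Epi (relTensor.proj M.act Q.actLeft))

instance (M : RightModule B) (Q : Bimod B A) (W : V) : Epi (tensorProj M Q ▷ W) :=
  inferInstanceAs (Epi (relTensor.proj M.act Q.actLeft ▷ W))

theorem tensorProj_act (M : RightModule B) (Q : Bimod B A) :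
    tensorProj M Q ▷ A.X ≫ (M.tensor Q).act =
      (α_ M.X Q.X A.X).hom ≫ M.X ◁ Q.actRight ≫ tensorProj M Q :=
  relTensor.proj_actRight M.act Q.actLeft Q.actRight Q.middle_assoc

/-- The underlying morphism of `f ⊗_B Q`. -/
noncomputable def tensorMapHom {M N : RightModule B} (f : M ⟶ N) (Q : Bimod B A) :
    (M.tensor Q).X ⟶ (N.tensor Q).X :=
  relTensor.map f.hom (𝟙 Q.X) f.act_hom (by simp)

theorem tensorProj_tensorMapHom {M N : RightModule B} (f : M ⟶ N) (Q : Bimod B A) :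
    tensorProj M Q ≫ tensorMapHom f Q = f.hom ▷ Q.X ≫ tensorProj N Q := by
  refine (relTensor.proj_map M.act Q.actLeft f.hom (𝟙 Q.X) f.act_hom _).trans ?_
  rw [MonoidalCategory.whiskerLeft_id, Category.id_comp]
  rfl

/-- The functor `- ⊗_B Q` from right `B`-modules to right `A`-modules. -/
noncomputable def tensorFunctor (Q : Bimod B A) : RightModule B ⥤ RightModule A where
  obj M := M.tensor Q
  map {M N} f :=
    { hom := tensorMapHom f Q
      act_hom := by
        rw [← cancel_epi (tensorProj M Q ▷ _), reassoc_of% (tensorProj_act M Q),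
          ← comp_whiskerRight_assoc, tensorProj_tensorMapHom]
        simp [tensorProj_act, whisker_exchange_assoc] }
  map_id M := by
    ext
    change tensorMapHom (𝟙 M) Q = 𝟙 _
    rw [← cancel_epi (tensorProj M Q), tensorProj_tensorMapHom]
    simp
  map_comp f g := by
    ext
    change tensorMapHom (f ≫ g) Q = tensorMapHom f Q ≫ tensorMapHom g Q
    rw [← cancel_epi (tensorProj _ Q), tensorProj_tensorMapHom,
      reassoc_of% (tensorProj_tensorMapHom f Q), tensorProj_tensorMapHom]
    simp

end

end RightModule


/-- The underlying right module of a bimodule. -/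
def RightModule.ofBimod {R S : Mon V} (P : Bimod R S) : RightModule S where
  X := P.X
  act := P.actRight
  act_one := P.actRight_one
  act_mul := P.right_assoc

end Modules

section Corings

variable {V : Type u} [Category.{v} V] [MonoidalCategory V] [HasCoequalizers V]
  [∀ W : V, PreservesColimitsOfShape WalkingParallelPair (tensorLeft W)]
  [∀ W : V, PreservesColimitsOfShape WalkingParallelPair (tensorRight W)]

section bimodTensor

variable {R S T U : Mon V}

/-- The tensor product `P ⊗_S Q` of bimodules, as a bimodule.  (The similar construction in
Mathlib asks the tensor product to preserve all small colimits instead of coequalizers.) -/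
noncomputable def bimodTensor (P : Bimod R S) (Q : Bimod S T) : Bimod R T where
  X := relTensor P.actRight Q.actLeft
  actLeft := relTensor.actLeft Q.actLeft P.actLeft P.middle_assoc
  actRight := relTensor.actRight P.actRight Q.actRight Q.middle_assoc
  one_actLeft := by
    rw [← cancel_epi (_ ◁ relTensor.proj _ _), whisker_exchange_assoc, relTensor.proj_actLeft,
      associator_inv_naturality_left_assoc, ← comp_whiskerRight_assoc, P.one_actLeft]
    simp
  left_assoc := by
    rw [← cancel_epi (_ ◁ relTensor.proj _ _), whisker_exchange_assoc, relTensor.proj_actLeft,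
      associator_inv_naturality_left_assoc, ← comp_whiskerRight_assoc, P.left_assoc,
      associator_naturality_right_assoc, ← MonoidalCategory.whiskerLeft_comp_assoc,
      relTensor.proj_actLeft]
    simp [relTensor.proj_actLeft]
  actRight_one := ((RightModule.ofBimod P).tensor Q).act_one
  right_assoc := ((RightModule.ofBimod P).tensor Q).act_mul
  middle_assoc := by
    rw [← cancel_epi ((_ ◁ relTensor.proj _ _) ▷ _), ← comp_whiskerRight_assoc,
      relTensor.proj_actLeft, associator_naturality_middle_assoc,
      ← MonoidalCategory.whiskerLeft_comp_assoc, relTensor.proj_actRight]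
    simp only [comp_whiskerRight, Category.assoc, relTensor.proj_actRight,
      MonoidalCategory.whiskerLeft_comp, relTensor.proj_actLeft]
    rw [associator_inv_naturality_right_assoc, whisker_exchange_assoc]
    simp

/-- The canonical projection `P ⊗ Q ⟶ P ⊗_S Q`. -/
noncomputable def bimodProj (P : Bimod R S) (Q : Bimod S T) : P.X ⊗ Q.X ⟶ (bimodTensor P Q).X :=
  relTensor.proj P.actRight Q.actLeft

variable (P : Bimod R S) (Q : Bimod S T)

instance : Epi (bimodProj P Q) := inferInstanceAs (Epi (relTensor.proj P.actRight Q.actLeft))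

instance (W : V) : Epi (bimodProj P Q ▷ W) :=
  inferInstanceAs (Epi (relTensor.proj P.actRight Q.actLeft ▷ W))

instance (W W' : V) : Epi (bimodProj P Q ▷ W ▷ W') :=
  inferInstanceAs (Epi (relTensor.proj P.actRight Q.actLeft ▷ W ▷ W'))

instance (W : V) : Epi (W ◁ bimodProj P Q) :=
  inferInstanceAs (Epi (W ◁ relTensor.proj P.actRight Q.actLeft))

theorem bimodProj_condition :
    P.actRight ▷ Q.X ≫ bimodProj P Q = (α_ _ _ _).hom ≫ P.X ◁ Q.actLeft ≫ bimodProj P Q :=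
  relTensor.condition P.actRight Q.actLeft

theorem bimodProj_actRight :
    bimodProj P Q ▷ T.X ≫ (bimodTensor P Q).actRight =
      (α_ _ _ _).hom ≫ P.X ◁ Q.actRight ≫ bimodProj P Q :=
  relTensor.proj_actRight P.actRight Q.actLeft Q.actRight Q.middle_assoc

theorem bimodProj_actLeft :
    R.X ◁ bimodProj P Q ≫ (bimodTensor P Q).actLeft =
      (α_ _ _ _).inv ≫ P.actLeft ▷ Q.X ≫ bimodProj P Q :=
  relTensor.proj_actLeft P.actRight Q.actLeft P.actLeft P.middle_assoc

variable {P Q} in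
/-- A balanced morphism on `P ⊗ Q` descends to `P ⊗_S Q`. -/
noncomputable def bimodDesc {Z : V} (f : P.X ⊗ Q.X ⟶ Z)
    (h : P.actRight ▷ Q.X ≫ f = (α_ _ _ _).hom ≫ P.X ◁ Q.actLeft ≫ f) :
    (bimodTensor P Q).X ⟶ Z :=
  relTensor.desc f h

theorem bimodProj_desc {Z : V} (f : P.X ⊗ Q.X ⟶ Z)
    (h : P.actRight ▷ Q.X ≫ f = (α_ _ _ _).hom ≫ P.X ◁ Q.actLeft ≫ f) :
    bimodProj P Q ≫ bimodDesc f h = f :=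
  relTensor.proj_desc _ _ _ _

/-- The underlying morphism of `f ⊗_S g`. -/
noncomputable def bimodMap {P P' : Bimod R S} {Q Q' : Bimod S T} (f : P ⟶ P') (g : Q ⟶ Q') :
    (bimodTensor P Q).X ⟶ (bimodTensor P' Q').X :=
  relTensor.map f.hom g.hom f.right_act_hom g.left_act_hom

theorem bimodProj_map {P P' : Bimod R S} {Q Q' : Bimod S T} (f : P ⟶ P') (g : Q ⟶ Q') :
    bimodProj P Q ≫ bimodMap f g = f.hom ▷ Q.X ≫ P'.X ◁ g.hom ≫ bimodProj P' Q' :=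
  relTensor.proj_map _ _ _ _ _ _

/-- The underlying morphism of the canonical isomorphism `R ⊗_R Q ≅ Q`. -/
noncomputable def bimodLeftUnitor (Q : Bimod S T) : (bimodTensor (Bimod.regular S) Q).X ⟶ Q.X :=
  bimodDesc Q.actLeft Q.left_assoc

theorem bimodProj_leftUnitor (Q : Bimod S T) :
    bimodProj (Bimod.regular S) Q ≫ bimodLeftUnitor Q = Q.actLeft :=
  bimodProj_desc _ _ _ _

/-- The underlying morphism of the canonical isomorphism `P ⊗_S S ≅ P`. -/
noncomputable def bimodRightUnitor (P : Bimod R S) : (bimodTensor P (Bimod.regular S)).X ⟶ P.X :=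
  bimodDesc P.actRight (by
    have h : (α_ _ _ _).hom ≫ P.X ◁ μ ≫ P.actRight = P.actRight ▷ _ ≫ P.actRight := by
      rw [P.right_assoc, Iso.hom_inv_id_assoc]
    exact h.symm)

theorem bimodProj_rightUnitor (P : Bimod R S) :
    bimodProj P (Bimod.regular S) ≫ bimodRightUnitor P = P.actRight :=
  bimodProj_desc _ _ _ _

/-- Auxiliary morphism `(P ⊗_S Q) ⊗ L ⟶ P ⊗_S (Q ⊗_T L)`. -/
noncomputable def bimodAssocAux (P : Bimod R S) (Q : Bimod S T) (L : Bimod T U) :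
    (bimodTensor P Q).X ⊗ L.X ⟶ (bimodTensor P (bimodTensor Q L)).X :=
  relTensor.descRight
    ((α_ _ _ _).hom ≫ P.X ◁ bimodProj Q L ≫ bimodProj P (bimodTensor Q L)) (by
    rw [associator_naturality_left_assoc, ← whisker_exchange_assoc, bimodProj_condition,
      associator_naturality_right_assoc, ← MonoidalCategory.whiskerLeft_comp_assoc,
      bimodProj_actLeft]
    simp)

theorem bimodProj_assocAux (P : Bimod R S) (Q : Bimod S T) (L : Bimod T U) :
    bimodProj P Q ▷ L.X ≫ bimodAssocAux P Q L =
      (α_ _ _ _).hom ≫ P.X ◁ bimodProj Q L ≫ bimodProj P (bimodTensor Q L) :=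
  relTensor.proj_descRight _ _ _ _

/-- The underlying morphism of the canonical isomorphism
`(P ⊗_S Q) ⊗_T L ≅ P ⊗_S (Q ⊗_T L)`. -/
noncomputable def bimodAssoc (P : Bimod R S) (Q : Bimod S T) (L : Bimod T U) :
    (bimodTensor (bimodTensor P Q) L).X ⟶ (bimodTensor P (bimodTensor Q L)).X :=
  bimodDesc (bimodAssocAux P Q L) (by
    rw [← cancel_epi (bimodProj P Q ▷ _ ▷ _), ← comp_whiskerRight_assoc, bimodProj_actRight,
      associator_naturality_left_assoc, ← whisker_exchange_assoc, bimodProj_assocAux]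
    simp only [comp_whiskerRight, Category.assoc, bimodProj_assocAux]
    have h : P.X ◁ Q.actRight ▷ L.X ≫ P.X ◁ bimodProj Q L =
        P.X ◁ (α_ _ _ _).hom ≫ P.X ◁ Q.X ◁ L.actLeft ≫ P.X ◁ bimodProj Q L := by
      rw [← MonoidalCategory.whiskerLeft_comp, bimodProj_condition]
      simp
    simp [reassoc_of% h])

theorem bimodProj_assoc (P : Bimod R S) (Q : Bimod S T) (L : Bimod T U) :
    bimodProj P Q ▷ L.X ≫ bimodProj (bimodTensor P Q) L ≫ bimodAssoc P Q L =
      (α_ _ _ _).hom ≫ P.X ◁ bimodProj Q L ≫ bimodProj P (bimodTensor Q L) := by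
  rw [bimodAssoc, bimodProj_desc, bimodProj_assocAux]

theorem bimodProj_map_leftUnitor {P : Bimod S S} {Q : Bimod S T} (f : P ⟶ Bimod.regular S)
    (f₀ : P.X ⟶ S.X) (h : f.hom = f₀) :
    bimodProj P Q ≫ bimodMap f (𝟙 Q) ≫ bimodLeftUnitor Q = f₀ ▷ Q.X ≫ Q.actLeft := by
  subst h
  rw [reassoc_of% (bimodProj_map f (𝟙 Q)), Bimod.id_hom', MonoidalCategory.whiskerLeft_id,
    Category.id_comp, bimodProj_leftUnitor]
  rfl

theorem bimodProj_map_rightUnitor {P : Bimod R S} {Q : Bimod S S} (f : Q ⟶ Bimod.regular S)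
    (f₀ : Q.X ⟶ S.X) (h : f.hom = f₀) :
    bimodProj P Q ≫ bimodMap (𝟙 P) f ≫ bimodRightUnitor P = P.X ◁ f₀ ≫ P.actRight := by
  subst h
  rw [reassoc_of% (bimodProj_map (𝟙 P) f), Bimod.id_hom', MonoidalCategory.id_whiskerRight,
    Category.id_comp, bimodProj_rightUnitor]
  rfl

end bimodTensor

/-- An `A`-coring: a coalgebra (comonoid) in `A`-`A`-bimodules with the tensor product over `A`. -/
structure Coring (A : Mon V) where
  M : Bimod A A
  counit : M ⟶ Bimod.regular A
  comul : M ⟶ bimodTensor M M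
  counit_comul : comul.hom ≫ bimodMap counit (𝟙 M) ≫ bimodLeftUnitor M = 𝟙 M.X
  comul_counit : comul.hom ≫ bimodMap (𝟙 M) counit ≫ bimodRightUnitor M = 𝟙 M.X
  coassoc : comul.hom ≫ bimodMap comul (𝟙 M) ≫ bimodAssoc M M M =
    comul.hom ≫ bimodMap (𝟙 M) comul

namespace Coring

variable {A : Mon V}

/-- A morphism of `A`-corings. -/
@[ext]
structure Hom (K L : Coring A) where
  hom : K.M ⟶ L.M
  counit : hom ≫ L.counit = K.counit
  comul : hom.hom ≫ L.comul.hom = K.comul.hom ≫ bimodMap hom hom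

noncomputable instance : Category (Coring A) where
  Hom K L := Hom K L
  id K := ⟨𝟙 K.M, by simp, by
    have h : bimodMap (𝟙 K.M) (𝟙 K.M) = 𝟙 _ := by
      rw [← cancel_epi (bimodProj _ _), bimodProj_map]
      simp
    rw [h]
    simp⟩
  comp {K L N} f g := ⟨f.hom ≫ g.hom, by rw [Category.assoc, g.counit, f.counit], by
    have h : bimodMap (f.hom ≫ g.hom) (f.hom ≫ g.hom) =
        bimodMap f.hom f.hom ≫ bimodMap g.hom g.hom := by
      rw [← cancel_epi (bimodProj _ _), bimodProj_map, reassoc_of% (bimodProj_map f.hom f.hom),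
        bimodProj_map]
      simp [whisker_exchange_assoc]
    rw [h, Bimod.comp_hom', Category.assoc, g.comul, reassoc_of% f.comul]⟩

end Coring

end Corings

section Sweedler

variable {V : Type u} [Category.{v} V] [MonoidalCategory V]

variable {A B : Mon V}

/-- `A` as a `B`-`A`-bimodule, for an algebra morphism `i : B ⟶ A`. -/
abbrev leftRestrict (i : B ⟶ A) : Bimod B A where
  X := A.X
  actLeft := i.hom ▷ A.X ≫ μ
  actRight := μ
  one_actLeft := by
    rw [← comp_whiskerRight_assoc, IsMonHom.one_hom, MonObj.one_mul]
  left_assoc := by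
    rw [← comp_whiskerRight_assoc, IsMonHom.mul_hom, MonoidalCategory.whiskerLeft_comp,
      Category.assoc, whisker_exchange_assoc, MonoidalCategory.tensorHom_def']
    simp
  actRight_one := MonObj.mul_one _
  right_assoc := by simp
  middle_assoc := by simp [whisker_exchange_assoc]

/-- `A` as an `A`-`B`-bimodule, for an algebra morphism `i : B ⟶ A`. -/
abbrev rightRestrict (i : B ⟶ A) : Bimod A B where
  X := A.X
  actLeft := μ
  actRight := A.X ◁ i.hom ≫ μ
  one_actLeft := MonObj.one_mul _
  left_assoc := by simp
  actRight_one := by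
    rw [← MonoidalCategory.whiskerLeft_comp_assoc, IsMonHom.one_hom, MonObj.mul_one]
  right_assoc := by
    rw [← MonoidalCategory.whiskerLeft_comp_assoc, IsMonHom.mul_hom, comp_whiskerRight,
      Category.assoc, ← whisker_exchange_assoc, MonoidalCategory.tensorHom_def]
    simp
  middle_assoc := by simp [← whisker_exchange_assoc]

variable [HasCoequalizers V]
  [∀ W : V, PreservesColimitsOfShape WalkingParallelPair (tensorRight W)]

/-- The extension-of-scalars functor `- ⊗_B A` along an algebra morphism `i : B ⟶ A`. -/
noncomputable def extensionOfScalars (i : B ⟶ A) : RightModule B ⥤ RightModule A :=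
  RightModule.tensorFunctor (leftRestrict i)

variable [∀ W : V, PreservesColimitsOfShape WalkingParallelPair (tensorLeft W)]

namespace Sweedler

variable (i : B ⟶ A)

/-- The `A`-`A`-bimodule `A ⊗_B A`. -/
noncomputable def bimod : Bimod A A := bimodTensor (rightRestrict i) (leftRestrict i)

/-- The canonical projection `A ⊗ A ⟶ A ⊗_B A`. -/
noncomputable def proj : A.X ⊗ A.X ⟶ (bimod i).X := bimodProj (rightRestrict i) (leftRestrict i)

instance : Epi (proj i) := inferInstanceAs (Epi (bimodProj (rightRestrict i) (leftRestrict i)))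

instance (W : V) : Epi (proj i ▷ W) :=
  inferInstanceAs (Epi (bimodProj (rightRestrict i) (leftRestrict i) ▷ W))

instance (W : V) : Epi (W ◁ proj i) :=
  inferInstanceAs (Epi (W ◁ bimodProj (rightRestrict i) (leftRestrict i)))

theorem condition : (A.X ◁ i.hom) ▷ A.X ≫ μ ▷ A.X ≫ proj i =
    (α_ _ _ _).hom ≫ A.X ◁ i.hom ▷ A.X ≫ A.X ◁ μ ≫ proj i := by
  have h := bimodProj_condition (rightRestrict i) (leftRestrict i)
  simp only [comp_whiskerRight, Category.assoc, MonoidalCategory.whiskerLeft_comp] at h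
  exact h

theorem proj_actRight :
    proj i ▷ A.X ≫ (bimod i).actRight = (α_ _ _ _).hom ≫ A.X ◁ μ ≫ proj i :=
  bimodProj_actRight (rightRestrict i) (leftRestrict i)

theorem proj_actLeft :
    A.X ◁ proj i ≫ (bimod i).actLeft = (α_ _ _ _).inv ≫ μ ▷ A.X ≫ proj i :=
  bimodProj_actLeft (rightRestrict i) (leftRestrict i)

variable {i} in
/-- A balanced morphism on `A ⊗ A` descends to `A ⊗_B A`. -/
noncomputable def desc {Z : V} (f : A.X ⊗ A.X ⟶ Z)
    (h : (A.X ◁ i.hom) ▷ A.X ≫ μ ▷ A.X ≫ f =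
      (α_ _ _ _).hom ≫ A.X ◁ i.hom ▷ A.X ≫ A.X ◁ μ ≫ f) : (bimod i).X ⟶ Z :=
  bimodDesc (P := rightRestrict i) (Q := leftRestrict i) f (by simpa using h)

theorem proj_desc {Z : V} (f : A.X ⊗ A.X ⟶ Z)
    (h : (A.X ◁ i.hom) ▷ A.X ≫ μ ▷ A.X ≫ f =
      (α_ _ _ _).hom ≫ A.X ◁ i.hom ▷ A.X ≫ A.X ◁ μ ≫ f) : proj i ≫ desc f h = f :=
  bimodProj_desc _ _ _ _

/-- The morphism `a ↦ a ⊗_B 1`. -/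
noncomputable def inl : A.X ⟶ (bimod i).X := (ρ_ A.X).inv ≫ A.X ◁ η ≫ proj i

/-- The morphism `a ↦ 1 ⊗_B a`. -/
noncomputable def inr : A.X ⟶ (bimod i).X := (λ_ A.X).inv ≫ η ▷ A.X ≫ proj i

theorem mul_inl : μ ≫ inl i = A.X ◁ inl i ≫ (bimod i).actLeft := by
  simp only [inl, MonoidalCategory.whiskerLeft_comp, Category.assoc, proj_actLeft]
  rw [rightUnitor_inv_naturality_assoc, ← whisker_exchange_assoc]
  simp

theorem mul_inr : μ ≫ inr i = inr i ▷ A.X ≫ (bimod i).actRight := by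
  simp only [inr, comp_whiskerRight, Category.assoc, proj_actRight]
  rw [leftUnitor_inv_naturality_assoc, whisker_exchange_assoc]
  simp

theorem inl_actRight : inl i ▷ A.X ≫ (bimod i).actRight = proj i := by
  simp only [inl, comp_whiskerRight, Category.assoc, proj_actRight, whisker_assoc,
    Iso.inv_hom_id_assoc]
  rw [← MonoidalCategory.whiskerLeft_comp_assoc, MonObj.one_mul]
  simp

theorem inr_actLeft : A.X ◁ inr i ≫ (bimod i).actLeft = proj i := by
  simp only [inr, MonoidalCategory.whiskerLeft_comp, Category.assoc, proj_actLeft]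
  rw [associator_inv_naturality_middle_assoc, ← comp_whiskerRight_assoc, MonObj.mul_one]
  simp

theorem inl_balanced : A.X ◁ i.hom ≫ μ ≫ inl i =
    inl i ▷ B.X ≫ (bimod i).X ◁ i.hom ≫ (bimod i).actRight := by
  rw [← whisker_exchange_assoc, inl_actRight, inl, rightUnitor_inv_naturality_assoc,
    rightUnitor_inv_naturality_assoc, ← whisker_exchange_assoc, ← whisker_exchange_assoc,
    condition]
  have h : A.X ◁ i.hom ▷ 𝟙_ V ≫ A.X ◁ A.X ◁ η ≫ A.X ◁ μ = A.X ◁ ((ρ_ _).hom ≫ i.hom) := by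
    simp only [← MonoidalCategory.whiskerLeft_comp, MonObj.mul_one]
    simp
  rw [tensor_whiskerLeft_assoc, Iso.inv_hom_id_assoc]
  rw [← MonoidalCategory.whiskerLeft_comp_assoc A.X (B.X ◁ η), whisker_exchange,
    MonoidalCategory.whiskerLeft_comp_assoc, reassoc_of% h]
  simp

theorem inr_balanced : i.hom ▷ A.X ≫ μ ≫ inr i =
    B.X ◁ inr i ≫ i.hom ▷ (bimod i).X ≫ (bimod i).actLeft := by
  rw [whisker_exchange_assoc, inr_actLeft, inr, leftUnitor_inv_naturality_assoc,
    leftUnitor_inv_naturality_assoc, whisker_exchange_assoc, whisker_exchange_assoc]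
  have h := condition i
  have h' : (A.X ◁ i.hom) ▷ A.X = (α_ _ _ _).hom ≫ A.X ◁ i.hom ▷ A.X ≫ (α_ _ _ _).inv := by simp
  rw [h', Category.assoc, Category.assoc, cancel_epi] at h
  rw [← h]
  have h : (𝟙_ V ◁ i.hom) ▷ A.X ≫ η ▷ A.X ▷ A.X ≫ μ ▷ A.X = ((λ_ _).hom ≫ i.hom) ▷ A.X := by
    simp only [← comp_whiskerRight, MonObj.one_mul]
    simp
  have h2 : η ▷ (B.X ⊗ A.X) ≫ A.X ◁ i.hom ▷ A.X ≫ (α_ _ _ _).inv =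
      (α_ _ _ _).inv ≫ (𝟙_ V ◁ i.hom) ▷ A.X ≫ η ▷ A.X ▷ A.X := by
    rw [← comp_whiskerRight, whisker_exchange]
    simp
  rw [reassoc_of% h2, reassoc_of% h]
  simp

theorem one_inl : η ≫ inl i = η ≫ inr i := by
  rw [inl, inr, rightUnitor_inv_naturality_assoc, leftUnitor_inv_naturality_assoc,
    whisker_exchange_assoc, unitors_inv_equal]

/-- The comultiplication of `A ⊗_B A`. -/
noncomputable def comulHom : (bimod i).X ⟶ (bimodTensor (bimod i) (bimod i)).X :=
  desc (inl i ▷ A.X ≫ (bimod i).X ◁ inr i ≫ bimodProj (bimod i) (bimod i)) (by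
    have h1 : (A.X ◁ i.hom) ▷ A.X ≫ μ ▷ A.X ≫ inl i ▷ A.X =
      inl i ▷ B.X ▷ A.X ≫ ((bimod i).X ◁ i.hom) ▷ A.X ≫ (bimod i).actRight ▷ A.X := by
      simp only [← comp_whiskerRight, inl_balanced]
    have h2 : (bimod i).X ◁ i.hom ▷ A.X ≫ (bimod i).X ◁ μ ≫ (bimod i).X ◁ inr i =
      (bimod i).X ◁ i.hom ▷ A.X ≫ (bimod i).X ◁ A.X ◁ inr i ≫
        (bimod i).X ◁ (bimod i).actLeft := by
      simp only [← MonoidalCategory.whiskerLeft_comp, inr_balanced, whisker_exchange_assoc]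
    rw [reassoc_of% h1, ← whisker_exchange_assoc, bimodProj_condition,
      whisker_exchange_assoc, whisker_exchange_assoc, reassoc_of% h2]
    simp)

theorem proj_comulHom : proj i ≫ comulHom i =
    inl i ▷ A.X ≫ (bimod i).X ◁ inr i ≫ bimodProj (bimod i) (bimod i) :=
  proj_desc _ _ _

/-- The comultiplication of `A ⊗_B A`. -/
noncomputable def comul : bimod i ⟶ bimodTensor (bimod i) (bimod i) where
  hom := comulHom i
  left_act_hom := by
    rw [← cancel_epi (A.X ◁ proj i), reassoc_of% (proj_actLeft i), proj_comulHom,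
      ← MonoidalCategory.whiskerLeft_comp_assoc, proj_comulHom]
    simp only [MonoidalCategory.whiskerLeft_comp, Category.assoc, bimodProj_actLeft]
    rw [← comp_whiskerRight_assoc, mul_inl, associator_inv_naturality_right_assoc,
      whisker_exchange_assoc]
    simp
  right_act_hom := by
    rw [← cancel_epi (proj i ▷ A.X), reassoc_of% (proj_actRight i), proj_comulHom,
      ← comp_whiskerRight_assoc, proj_comulHom]
    simp only [comp_whiskerRight, Category.assoc, bimodProj_actRight]
    rw [whisker_exchange_assoc, ← MonoidalCategory.whiskerLeft_comp_assoc, mul_inr]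
    simp

/-- The counit `A ⊗_B A ⟶ A`, `a ⊗_B b ↦ ab`. -/
noncomputable def counitHom : (bimod i).X ⟶ A.X :=
  desc μ (by simp)

theorem proj_counitHom : proj i ≫ counitHom i = μ := proj_desc _ _ _

theorem actLeft_counitHom : (bimod i).actLeft ≫ counitHom i = A.X ◁ counitHom i ≫ μ := by
  rw [← cancel_epi (A.X ◁ proj i), reassoc_of% (proj_actLeft i), proj_counitHom,
    ← MonoidalCategory.whiskerLeft_comp_assoc, proj_counitHom]
  simp

theorem actRight_counitHom : (bimod i).actRight ≫ counitHom i = counitHom i ▷ A.X ≫ μ := by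
  rw [← cancel_epi (proj i ▷ A.X), reassoc_of% (proj_actRight i), proj_counitHom,
    ← comp_whiskerRight_assoc, proj_counitHom]
  simp

/-- The counit of `A ⊗_B A`, as a bimodule morphism. -/
noncomputable def counit : bimod i ⟶ Bimod.regular A where
  hom := counitHom i
  left_act_hom := actLeft_counitHom i
  right_act_hom := actRight_counitHom i

theorem inl_counit : inl i ≫ counitHom i = 𝟙 _ := by
  simp [inl, proj_counitHom]

theorem inr_counit : inr i ≫ counitHom i = 𝟙 _ := by
  simp [inr, proj_counitHom]

theorem inl_comul : inl i ≫ comulHom i =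
    (ρ_ _).inv ≫ inl i ▷ 𝟙_ V ≫ (bimod i).X ◁ (η ≫ inr i) ≫ bimodProj (bimod i) (bimod i) := by
  rw [inl, Category.assoc, Category.assoc, proj_comulHom, whisker_exchange_assoc]
  simp [inl]

theorem inr_comul : inr i ≫ comulHom i =
    (λ_ _).inv ≫ (η ≫ inr i) ▷ A.X ≫ (bimod i).X ◁ inr i ≫ bimodProj (bimod i) (bimod i) := by
  rw [← one_inl, inr, Category.assoc, Category.assoc, proj_comulHom]
  simp [inr]

end Sweedler

/-- The canonical `A`-coring `A ⊗_B A` of an algebra morphism `i : B ⟶ A`. -/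
noncomputable def sweedlerCoring (i : B ⟶ A) : Coring A where
  M := Sweedler.bimod i
  counit := Sweedler.counit i
  comul := Sweedler.comul i
  counit_comul := by
    change Sweedler.comulHom i ≫ _ = _
    rw [← cancel_epi (Sweedler.proj i), reassoc_of% (Sweedler.proj_comulHom i),
      bimodProj_map_leftUnitor (Sweedler.counit i) (Sweedler.counitHom i) rfl,
      whisker_exchange_assoc, ← comp_whiskerRight_assoc, Sweedler.inl_counit,
      Sweedler.inr_actLeft]
    simp
  comul_counit := by
    change Sweedler.comulHom i ≫ _ = _
    rw [← cancel_epi (Sweedler.proj i), reassoc_of% (Sweedler.proj_comulHom i),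
      bimodProj_map_rightUnitor (Sweedler.counit i) (Sweedler.counitHom i) rfl,
      ← MonoidalCategory.whiskerLeft_comp_assoc, Sweedler.inr_counit,
      MonoidalCategory.whiskerLeft_id, Category.id_comp, Sweedler.inl_actRight]
    simp
  coassoc := by
    change Sweedler.comulHom i ≫ _ = Sweedler.comulHom i ≫ _
    rw [← cancel_epi (Sweedler.proj i), reassoc_of% (Sweedler.proj_comulHom i),
      reassoc_of% (Sweedler.proj_comulHom i),
      reassoc_of% (bimodProj_map (Sweedler.comul i) (𝟙 (Sweedler.bimod i))),
      bimodProj_map]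
    change _ ≫ _ ≫ Sweedler.comulHom i ▷ _ ≫ _ =
      _ ≫ _ ≫ _ ≫ _ ◁ Sweedler.comulHom i ≫ _
    rw [whisker_exchange_assoc, ← comp_whiskerRight_assoc, Sweedler.inl_comul]
    simp only [Bimod.id_hom', MonoidalCategory.whiskerLeft_id, Category.id_comp,
      MonoidalCategory.id_whiskerRight]
    rw [← MonoidalCategory.whiskerLeft_comp_assoc, Sweedler.inr_comul]
    simp only [comp_whiskerRight, Category.assoc]
    rw [← whisker_exchange_assoc (bimodProj _ _), bimodProj_assoc]
    simp only [MonoidalCategory.whiskerLeft_comp, Category.assoc]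
    simp

end Sweedler

section Entwining

variable {V : Type u} [Category.{v} V] [MonoidalCategory V]

/-- An entwining structure `(C, A, lam)`: the morphism `lam : C ⊗ A ⟶ A ⊗ C` is compatible with the
unit and multiplication of `A` and the counit and comultiplication of `C`, that is, `- ⊗ lam` is a
mixed distributive law from the monad `- ⊗ A` to the comonad `- ⊗ C`. -/
structure EntwiningStructure (C : Comon V) (A : Mon V) where
  lam : C.X ⊗ A.X ⟶ A.X ⊗ C.X
  lam_one : C.X ◁ η[A.X] ≫ lam = (ρ_ C.X).hom ≫ (λ_ C.X).inv ≫ η[A.X] ▷ C.X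
  lam_mul : C.X ◁ μ[A.X] ≫ lam = (α_ _ _ _).inv ≫ lam ▷ A.X ≫ (α_ _ _ _).hom ≫
    A.X ◁ lam ≫ (α_ _ _ _).inv ≫ μ[A.X] ▷ C.X
  lam_counit : lam ≫ A.X ◁ ε[C.X] = ε[C.X] ▷ A.X ≫ (λ_ A.X).hom ≫ (ρ_ A.X).inv
  lam_comul : lam ≫ A.X ◁ Δ[C.X] = Δ[C.X] ▷ A.X ≫ (α_ _ _ _).hom ≫ C.X ◁ lam ≫
    (α_ _ _ _).inv ≫ lam ▷ C.X ≫ (α_ _ _ _).hom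

/-- A group-like element of a coalgebra `C`. -/
structure GroupLike (C : Comon V) where
  hom : 𝟙_ V ⟶ C.X
  hom_counit : hom ≫ ε[C.X] = 𝟙 (𝟙_ V)
  hom_comul : hom ≫ Δ[C.X] = (λ_ (𝟙_ V)).inv ≫ (hom ⊗ₘ hom)

variable {C : Comon V} {A : Mon V}

/-- An entwined module over an entwining structure: an object of `V` which is a right `A`-module
and a right `C`-comodule, compatibly with `lam`. -/
structure EntwinedModule (E : EntwiningStructure C A) extends RightModule A where
  coact : X ⟶ X ⊗ C.X
  coact_counit : coact ≫ X ◁ ε[C.X] = (ρ_ X).inv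
  coact_comul : coact ≫ X ◁ Δ[C.X] = coact ≫ coact ▷ C.X ≫ (α_ X C.X C.X).hom
  compat : act ≫ coact = coact ▷ A.X ≫ (α_ _ _ _).hom ≫ X ◁ E.lam ≫ (α_ _ _ _).inv ≫ act ▷ C.X

namespace EntwinedModule

variable {E : EntwiningStructure C A}

/-- A morphism of entwined modules is a morphism of right modules and of right comodules. -/
@[ext]
structure Hom (M N : EntwinedModule E) extends RightModule.Hom M.toRightModule N.toRightModule where
  coact_hom : M.coact ≫ hom ▷ C.X = hom ≫ N.coact

instance : Category (EntwinedModule E) where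
  Hom M N := Hom M N
  id M := ⟨𝟙 M.toRightModule, by simp⟩
  comp {M N P} f g :=
    { (show M.toRightModule ⟶ P.toRightModule from
        (show M.toRightModule ⟶ N.toRightModule from f.toHom) ≫ g.toHom) with
      coact_hom := by
        change M.coact ≫ (f.hom ≫ g.hom) ▷ C.X = (f.hom ≫ g.hom) ≫ P.coact
        rw [comp_whiskerRight, reassoc_of% f.coact_hom, g.coact_hom, Category.assoc] }

end EntwinedModule

namespace EntwiningStructure

variable (E : EntwiningStructure C A)

/-- The `A`-`A`-bimodule `A ⊗ C` of an entwining structure. -/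
abbrev bimod : Bimod A A where
  X := A.X ⊗ C.X
  actLeft := (α_ A.X A.X C.X).inv ≫ μ ▷ C.X
  actRight := (α_ A.X C.X A.X).hom ≫ A.X ◁ E.lam ≫ (α_ A.X A.X C.X).inv ≫ μ ▷ C.X
  one_actLeft := by
    rw [associator_inv_naturality_left_assoc, ← comp_whiskerRight, MonObj.one_mul]
    simp
  left_assoc := by
    rw [associator_inv_naturality_left_assoc, ← comp_whiskerRight, MonObj.mul_assoc]
    simp
  actRight_one := by
    rw [tensor_whiskerLeft_assoc, Iso.inv_hom_id_assoc,
      ← MonoidalCategory.whiskerLeft_comp_assoc, E.lam_one]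
    simp only [MonoidalCategory.whiskerLeft_comp, Category.assoc]
    rw [associator_inv_naturality_middle_assoc, ← comp_whiskerRight, MonObj.mul_one]
    simp
  right_assoc := by
    have h : (α_ _ _ _).inv ≫ (α_ _ _ _).inv ≫ μ[A.X] ▷ A.X ▷ C.X ≫ μ ▷ C.X =
        A.X ◁ (α_ _ _ _).inv ≫ A.X ◁ μ ▷ C.X ≫ (α_ _ _ _).inv ≫ μ ▷ C.X := by
      rw [← comp_whiskerRight, MonObj.mul_assoc]
      simp
    rw [tensor_whiskerLeft_assoc, Iso.inv_hom_id_assoc,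
      ← MonoidalCategory.whiskerLeft_comp_assoc, E.lam_mul]
    simp only [MonoidalCategory.whiskerLeft_comp, Category.assoc, comp_whiskerRight]
    rw [associator_naturality_left_assoc, ← whisker_exchange_assoc]
    simp [h]
  middle_assoc := by
    simp only [comp_whiskerRight, Category.assoc, MonoidalCategory.whiskerLeft_comp]
    rw [associator_naturality_left_assoc, ← whisker_exchange_assoc,
      associator_inv_naturality_left_assoc, associator_inv_naturality_middle_assoc,
      ← comp_whiskerRight, ← comp_whiskerRight, MonObj.mul_assoc]
    simp

/-- The morphism `c ↦ 1 ⊗ c`. -/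
def unitC : C.X ⟶ A.X ⊗ C.X := (λ_ C.X).inv ≫ η[A.X] ▷ C.X

theorem unitC_actLeft : A.X ◁ unitC ≫ E.bimod.actLeft = 𝟙 (A.X ⊗ C.X) := by
  simp only [unitC, MonoidalCategory.whiskerLeft_comp, Category.assoc]
  rw [associator_inv_naturality_middle_assoc, ← comp_whiskerRight, MonObj.mul_one]
  simp

theorem unitC_actRight : unitC ▷ A.X ≫ E.bimod.actRight = E.lam := by
  simp only [unitC, comp_whiskerRight, Category.assoc]
  rw [associator_naturality_left_assoc, ← whisker_exchange_assoc,
    associator_inv_naturality_left_assoc, ← comp_whiskerRight, MonObj.one_mul]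
  simp

variable (g : GroupLike C)

/-- The coaction `A ⟶ A ⊗ C` of `C` on `A` induced by a group-like element. -/
def coact : A.X ⟶ A.X ⊗ C.X := (λ_ A.X).inv ≫ g.hom ▷ A.X ≫ E.lam

theorem coact_counit : E.coact g ≫ A.X ◁ ε[C.X] = (ρ_ A.X).inv := by
  simp only [coact, Category.assoc, E.lam_counit]
  rw [← comp_whiskerRight_assoc, g.hom_counit]
  simp

theorem coact_comul : E.coact g ≫ A.X ◁ Δ[C.X] =
    E.coact g ≫ E.coact g ▷ C.X ≫ (α_ A.X C.X C.X).hom := by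
  simp only [coact, Category.assoc, E.lam_comul]
  rw [← comp_whiskerRight_assoc, g.hom_comul, MonoidalCategory.tensorHom_def]
  simp only [comp_whiskerRight, Category.assoc]
  have e : (λ_ A.X).inv ▷ C.X = (λ_ (A.X ⊗ C.X)).inv ≫ (α_ _ _ _).inv := by simp
  rw [e, Category.assoc, ← associator_inv_naturality_left_assoc,
    leftUnitor_inv_naturality_assoc E.lam, whisker_exchange_assoc,
    leftUnitor_inv_naturality_assoc (g.hom ▷ A.X), whisker_exchange_assoc]
  simp

theorem mul_coact : μ ≫ E.coact g = E.coact g ▷ A.X ≫ (α_ _ _ _).hom ≫ A.X ◁ E.lam ≫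
    (α_ _ _ _).inv ≫ μ ▷ C.X := by
  rw [coact, leftUnitor_inv_naturality_assoc, whisker_exchange_assoc, E.lam_mul]
  simp

theorem one_coact : η ≫ E.coact g = η ≫ (ρ_ A.X).inv ≫ A.X ◁ g.hom := by
  rw [coact, leftUnitor_inv_naturality_assoc, whisker_exchange_assoc, E.lam_one,
    rightUnitor_inv_naturality_assoc, ← whisker_exchange]
  simp [unitors_inv_equal]
  rw [unitors_equal, Iso.inv_hom_id_assoc]


theorem comp_mul_coact {W : V} (f : W ⟶ A.X)
    (h : f ≫ E.coact g = f ≫ (ρ_ A.X).inv ≫ A.X ◁ g.hom) :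
    f ▷ A.X ≫ μ ≫ E.coact g = f ▷ A.X ≫ A.X ◁ E.coact g ≫ E.bimod.actLeft := by
  rw [mul_coact, ← comp_whiskerRight_assoc, h]
  simp [coact]

theorem coact_eq : E.coact g = (λ_ _).inv ≫ (g.hom ≫ unitC) ▷ A.X ≫ E.bimod.actRight := by
  rw [comp_whiskerRight_assoc, unitC_actRight, coact]

theorem comp_unitC : g.hom ≫ unitC = η[A.X] ≫ (ρ_ A.X).inv ≫ A.X ◁ g.hom := by
  rw [unitC, leftUnitor_inv_naturality_assoc, whisker_exchange, rightUnitor_inv_naturality_assoc,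
    unitors_inv_equal]

/-- `A ⊗ Δ`. -/
def comulAux : A.X ⊗ C.X ⟶ (A.X ⊗ C.X) ⊗ C.X := A.X ◁ Δ ≫ (α_ _ _ _).inv

/-- `A ⊗ ε`. -/
def counitHom : A.X ⊗ C.X ⟶ A.X := A.X ◁ ε ≫ (ρ_ A.X).hom

theorem actLeft_comulAux : E.bimod.actLeft ≫ comulAux =
    A.X ◁ comulAux ≫ (α_ _ _ _).inv ≫ E.bimod.actLeft ▷ C.X := by
  simp only [comulAux, Category.assoc]
  rw [← whisker_exchange_assoc]
  simp

theorem actRight_comulAux : E.bimod.actRight ≫ comulAux =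
    comulAux ▷ A.X ≫ (α_ _ _ _).hom ≫ (A.X ⊗ C.X) ◁ E.lam ≫ (α_ _ _ _).inv ≫
      E.bimod.actRight ▷ C.X := by
  have h : A.X ◁ E.lam ≫ A.X ◁ A.X ◁ Δ[C.X] =
      A.X ◁ (Δ[C.X] ▷ A.X ≫ (α_ _ _ _).hom ≫ C.X ◁ E.lam ≫
        (α_ _ _ _).inv ≫ E.lam ▷ C.X ≫ (α_ _ _ _).hom) := by
    rw [← MonoidalCategory.whiskerLeft_comp, E.lam_comul]
  simp only [comulAux, Category.assoc]
  rw [← whisker_exchange_assoc, tensor_whiskerLeft_assoc, Iso.inv_hom_id_assoc, reassoc_of% h]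
  simp

theorem comulAux_comulAux : comulAux (A := A) (C := C) ≫ comulAux ▷ C.X ≫ (α_ _ _ _).hom =
    comulAux ≫ (A.X ⊗ C.X) ◁ Δ := by
  simp only [comulAux, Category.assoc, comp_whiskerRight, tensor_whiskerLeft,
    Iso.inv_hom_id_assoc]
  have h : A.X ◁ Δ[C.X] ≫ A.X ◁ C.X ◁ Δ[C.X] = A.X ◁ (Δ[C.X] ≫ Δ[C.X] ▷ C.X ≫
      (α_ _ _ _).hom) := by
    rw [← MonoidalCategory.whiskerLeft_comp, ComonObj.comul_assoc]
  rw [reassoc_of% h]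
  simp

theorem actLeft_counitHom : E.bimod.actLeft ≫ counitHom = A.X ◁ counitHom ≫ μ := by
  simp only [counitHom, Category.assoc]
  rw [← whisker_exchange_assoc]
  simp

theorem actRight_counitHom : E.bimod.actRight ≫ counitHom = counitHom ▷ A.X ≫ μ := by
  simp only [counitHom, Category.assoc]
  have h : A.X ◁ E.lam ≫ A.X ◁ A.X ◁ ε[C.X] =
      A.X ◁ (ε[C.X] ▷ A.X ≫ (λ_ A.X).hom ≫ (ρ_ A.X).inv) := by
    rw [← MonoidalCategory.whiskerLeft_comp, E.lam_counit]
  rw [← whisker_exchange_assoc, tensor_whiskerLeft_assoc, Iso.inv_hom_id_assoc, reassoc_of% h]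
  simp

theorem coact_counitHom : E.coact g ≫ counitHom = 𝟙 _ := by
  rw [counitHom, reassoc_of% (E.coact_counit g), Iso.inv_hom_id]

theorem unitC_comulAux : unitC ≫ comulAux (A := A) (C := C) = Δ ≫ unitC ▷ C.X := by
  rw [unitC, comulAux, Category.assoc, ← whisker_exchange_assoc, ← leftUnitor_inv_naturality_assoc]
  simp

theorem comulAux_counit : comulAux ≫ counitHom ▷ C.X = 𝟙 (A.X ⊗ C.X) := by
  have h : A.X ◁ Δ[C.X] ≫ A.X ◁ ε[C.X] ▷ C.X = A.X ◁ (λ_ C.X).inv := by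
    rw [← MonoidalCategory.whiskerLeft_comp, ComonObj.counit_comul]
  simp [comulAux, counitHom, reassoc_of% h]

theorem comulAux_counit' : comulAux ≫ (A.X ⊗ C.X) ◁ ε = (ρ_ (A.X ⊗ C.X)).inv := by
  have h : A.X ◁ Δ[C.X] ≫ A.X ◁ C.X ◁ ε[C.X] = A.X ◁ (ρ_ C.X).inv := by
    rw [← MonoidalCategory.whiskerLeft_comp, ComonObj.comul_counit]
  simp [comulAux, reassoc_of% h]

theorem unitC_counitHom : unitC (A := A) (C := C) ≫ counitHom = ε ≫ η := by
  rw [unitC, counitHom, Category.assoc, ← whisker_exchange_assoc,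
    ← leftUnitor_inv_naturality_assoc]
  simp [unitors_inv_equal]

end EntwiningStructure

section

variable [HasCoequalizers V]
  [∀ W : V, PreservesColimitsOfShape WalkingParallelPair (tensorLeft W)]
  [∀ W : V, PreservesColimitsOfShape WalkingParallelPair (tensorRight W)]

namespace EntwiningStructure

variable (E : EntwiningStructure C A)

theorem proj_eq : bimodProj E.bimod E.bimod =
    (α_ (A.X ⊗ C.X) A.X C.X).inv ≫ E.bimod.actRight ▷ C.X ≫ (A.X ⊗ C.X) ◁ unitC ≫
      bimodProj E.bimod E.bimod := by
  have h := bimodProj_condition E.bimod E.bimod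
  have h2 : (A.X ⊗ C.X) ◁ A.X ◁ unitC ≫ (A.X ⊗ C.X) ◁ E.bimod.actLeft = 𝟙 _ := by
    rw [← MonoidalCategory.whiskerLeft_comp, E.unitC_actLeft, MonoidalCategory.whiskerLeft_id]
  rw [← whisker_exchange_assoc, h, tensor_whiskerLeft_assoc, Iso.inv_hom_id_assoc]
  erw [Iso.inv_hom_id_assoc]
  rw [reassoc_of% h2]

/-- The comultiplication of `A ⊗ C`. -/
noncomputable def comulHom : A.X ⊗ C.X ⟶ (bimodTensor E.bimod E.bimod).X :=
  comulAux ≫ (A.X ⊗ C.X) ◁ unitC ≫ bimodProj E.bimod E.bimod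

theorem actLeft_comulHom : E.bimod.actLeft ≫ E.comulHom =
    A.X ◁ E.comulHom ≫ (bimodTensor E.bimod E.bimod).actLeft := by
  simp only [comulHom, MonoidalCategory.whiskerLeft_comp, Category.assoc, bimodProj_actLeft]
  rw [reassoc_of% E.actLeft_comulAux, ← whisker_exchange_assoc,
    associator_inv_naturality_right_assoc]

theorem actRight_comulHom : E.bimod.actRight ≫ E.comulHom =
    E.comulHom ▷ A.X ≫ (bimodTensor E.bimod E.bimod).actRight := by
  simp only [comulHom, comp_whiskerRight, Category.assoc, bimodProj_actRight]
  rw [reassoc_of% E.actRight_comulAux, ← E.proj_eq]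
  have h : (A.X ⊗ C.X) ◁ unitC ▷ A.X ≫ (A.X ⊗ C.X) ◁ E.bimod.actRight =
      (A.X ⊗ C.X) ◁ E.lam := by
    rw [← MonoidalCategory.whiskerLeft_comp, E.unitC_actRight]
  rw [associator_naturality_middle_assoc, reassoc_of% h]

/-- The comultiplication of `A ⊗ C`, as a bimodule morphism. -/
noncomputable def comul : E.bimod ⟶ bimodTensor E.bimod E.bimod where
  hom := E.comulHom
  left_act_hom := E.actLeft_comulHom
  right_act_hom := E.actRight_comulHom

/-- The counit of `A ⊗ C`, as a bimodule morphism. -/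
def counit : E.bimod ⟶ Bimod.regular A where
  hom := counitHom
  left_act_hom := E.actLeft_counitHom
  right_act_hom := E.actRight_counitHom

/-- The `A`-coring `A ⊗ C` of an entwining structure. -/
noncomputable def coring : Coring A where
  M := E.bimod
  counit := E.counit
  comul := E.comul
  counit_comul := by
    change E.comulHom ≫ _ = 𝟙 (A.X ⊗ C.X)
    rw [comulHom, Category.assoc, Category.assoc,
      bimodProj_map_leftUnitor E.counit counitHom rfl, whisker_exchange_assoc, E.unitC_actLeft]
    rw [Category.comp_id, comulAux_counit]
  comul_counit := by
    change E.comulHom ≫ _ = 𝟙 (A.X ⊗ C.X)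
    rw [comulHom, Category.assoc, Category.assoc,
      bimodProj_map_rightUnitor E.counit counitHom rfl,
      ← MonoidalCategory.whiskerLeft_comp_assoc, unitC_counitHom,
      MonoidalCategory.whiskerLeft_comp_assoc, reassoc_of% comulAux_counit', E.bimod.actRight_one,
      Iso.inv_hom_id]
  coassoc := by
    change E.comulHom ≫ _ = E.comulHom ≫ _
    simp only [comulHom, Category.assoc]
    rw [reassoc_of% (bimodProj_map E.comul (𝟙 E.bimod)), bimodProj_map]
    change _ ≫ _ ≫ E.comulHom ▷ _ ≫ _ ≫ _ ≫ _ =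
      _ ≫ _ ≫ _ ≫ _ ◁ E.comulHom ≫ _
    simp only [Bimod.id_hom', MonoidalCategory.whiskerLeft_id, Category.id_comp,
      MonoidalCategory.id_whiskerRight]
    simp only [comulHom, comp_whiskerRight, Category.assoc]
    have h := bimodProj_assoc E.bimod E.bimod E.bimod
    rw [h, whisker_exchange_assoc, ← MonoidalCategory.whiskerLeft_comp_assoc,
      reassoc_of% unitC_comulAux]
    simp only [MonoidalCategory.whiskerLeft_comp, Category.assoc]
    rw [← reassoc_of% comulAux_comulAux]
    have h' : (A.X ⊗ C.X) ◁ unitC ▷ C.X ≫ (A.X ⊗ C.X) ◁ (A.X ⊗ C.X) ◁ unitC (A := A) (C := C) =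
        (A.X ⊗ C.X) ◁ C.X ◁ unitC ≫ (A.X ⊗ C.X) ◁ unitC ▷ (A.X ⊗ C.X) := by
      rw [← MonoidalCategory.whiskerLeft_comp, ← whisker_exchange,
        MonoidalCategory.whiskerLeft_comp]
    rw [reassoc_of% h']
    simp

end EntwiningStructure

end

end Entwining

section Main

variable {V : Type u} [Category.{v} V] [MonoidalCategory V] {C : Comon V} {A : Mon V}

namespace EntwiningStructure

variable (E : EntwiningStructure C A) (g : GroupLike C)

section coinvariants

variable [HasEqualizers V]

/-- The underlying object of `A^C`: the equalizer of the coaction `A ⟶ A ⊗ C` and of `A ⊗ g`. -/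
noncomputable def coinvObj : V := equalizer (E.coact g) ((ρ_ A.X).inv ≫ A.X ◁ g.hom)

/-- The inclusion `A^C ⟶ A`. -/
noncomputable def coinvι : E.coinvObj g ⟶ A.X := equalizer.ι _ _

theorem coinvι_condition :
    E.coinvι g ≫ E.coact g = E.coinvι g ≫ (ρ_ A.X).inv ≫ A.X ◁ g.hom :=
  equalizer.condition _ _

instance : Mono (E.coinvι g) := equalizer.ι_mono

variable {E g} in
/-- The lift of a morphism to `A` to the equalizer `A^C`. -/
noncomputable def coinvLift {W : V} (f : W ⟶ A.X)
    (h : f ≫ E.coact g = f ≫ (ρ_ A.X).inv ≫ A.X ◁ g.hom) : W ⟶ E.coinvObj g :=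
  equalizer.lift f h

theorem coinvLift_ι {W : V} (f : W ⟶ A.X)
    (h : f ≫ E.coact g = f ≫ (ρ_ A.X).inv ≫ A.X ◁ g.hom) : coinvLift f h ≫ E.coinvι g = f :=
  equalizer.lift_ι _ _

/-- The unit of the algebra `A^C`. -/
noncomputable def coinvOne : 𝟙_ V ⟶ E.coinvObj g := coinvLift η (E.one_coact g)

/-- The multiplication of the algebra `A^C`. -/
noncomputable def coinvMul : E.coinvObj g ⊗ E.coinvObj g ⟶ E.coinvObj g :=
  coinvLift ((E.coinvι g ⊗ₘ E.coinvι g) ≫ μ) (by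
    have h : A.X ◁ ((ρ_ A.X).inv ≫ A.X ◁ g.hom) ≫ E.bimod.actLeft =
        μ ≫ (ρ_ A.X).inv ≫ A.X ◁ g.hom := by
      rw [rightUnitor_inv_naturality_assoc, ← whisker_exchange]
      simp
    rw [MonoidalCategory.tensorHom_def', Category.assoc, Category.assoc,
      comp_mul_coact _ _ _ (coinvι_condition E g), whisker_exchange_assoc,
      ← MonoidalCategory.whiskerLeft_comp_assoc, coinvι_condition,
      MonoidalCategory.whiskerLeft_comp_assoc, ← whisker_exchange_assoc, h]
    simp only [Category.assoc])

theorem coinvOne_ι : E.coinvOne g ≫ E.coinvι g = η := coinvLift_ι _ _ _ _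

theorem coinvMul_ι : E.coinvMul g ≫ E.coinvι g = (E.coinvι g ⊗ₘ E.coinvι g) ≫ μ :=
  coinvLift_ι _ _ _ _

/-- The algebra `A^C`. -/
noncomputable instance : MonObj (E.coinvObj g) where
  one := E.coinvOne g
  mul := E.coinvMul g
  one_mul := by
    rw [← cancel_mono (E.coinvι g), Category.assoc, coinvMul_ι, MonoidalCategory.tensorHom_def,
      Category.assoc, ← comp_whiskerRight_assoc, coinvOne_ι, ← whisker_exchange_assoc,
      MonObj.one_mul, leftUnitor_naturality]
  mul_one := by
    rw [← cancel_mono (E.coinvι g), Category.assoc, coinvMul_ι, MonoidalCategory.tensorHom_def',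
      Category.assoc, ← MonoidalCategory.whiskerLeft_comp_assoc, coinvOne_ι,
      whisker_exchange_assoc, MonObj.mul_one, rightUnitor_naturality]
  mul_assoc := by
    have h1 : E.coinvMul g ▷ _ ≫ (E.coinvι g ⊗ₘ E.coinvι g) =
        ((E.coinvι g ⊗ₘ E.coinvι g) ⊗ₘ E.coinvι g) ≫ μ ▷ A.X := by
      rw [MonoidalCategory.tensorHom_def, ← comp_whiskerRight_assoc, coinvMul_ι,
        ← MonoidalCategory.tensorHom_def, ← tensorHom_id _ A.X, tensorHom_comp_tensorHom,
        Category.comp_id, ← MonoidalCategory.tensorHom_def]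
    have h2 : _ ◁ E.coinvMul g ≫ (E.coinvι g ⊗ₘ E.coinvι g) =
        (E.coinvι g ⊗ₘ (E.coinvι g ⊗ₘ E.coinvι g)) ≫ A.X ◁ μ := by
      rw [MonoidalCategory.tensorHom_def', ← MonoidalCategory.whiskerLeft_comp_assoc, coinvMul_ι,
        ← MonoidalCategory.tensorHom_def', ← id_tensorHom A.X, tensorHom_comp_tensorHom,
        Category.comp_id, ← MonoidalCategory.tensorHom_def']
    simp only [← cancel_mono (E.coinvι g), Category.assoc, coinvMul_ι]
    rw [reassoc_of% h1, reassoc_of% h2, MonObj.mul_assoc, associator_naturality_assoc]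

/-- The algebra `A^C` of coinvariants. -/
noncomputable def coinvariants : Mon V := ⟨E.coinvObj g⟩

/-- The inclusion `A^C ⟶ A`, as a morphism of algebras. -/
noncomputable def coinvIncl : E.coinvariants g ⟶ A where
  hom := E.coinvι g
  isMonHom_hom :=
    { one_hom := coinvLift_ι _ _ _ _
      mul_hom := coinvLift_ι _ _ _ _ }

theorem coinvIncl_mul_coact : (E.coinvIncl g).hom ▷ A.X ≫ μ ≫ E.coact g =
    (E.coinvIncl g).hom ▷ A.X ≫ A.X ◁ E.coact g ≫ E.bimod.actLeft :=
  E.comp_mul_coact g (E.coinvι g) (E.coinvι_condition g)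

end coinvariants

section galois

variable [HasEqualizers V] [HasCoequalizers V]
  [∀ W : V, PreservesColimitsOfShape WalkingParallelPair (tensorLeft W)]
  [∀ W : V, PreservesColimitsOfShape WalkingParallelPair (tensorRight W)]

/-- The underlying morphism of `can`: it is induced by
`A ⊗ A ⟶ A ⊗ A ⊗ C ⟶ A ⊗ C`, the coaction of `A` followed by the multiplication. -/
noncomputable def canHom : (Sweedler.bimod (E.coinvIncl g)).X ⟶ A.X ⊗ C.X :=
  Sweedler.desc (A.X ◁ E.coact g ≫ (α_ A.X A.X C.X).inv ≫ μ ▷ C.X) (by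
    have h : (A.X ◁ (E.coinvIncl g).hom) ▷ A.X ≫ μ ▷ A.X ≫ A.X ◁ E.coact g ≫ E.bimod.actLeft =
        (α_ _ _ _).hom ≫ A.X ◁ (E.coinvIncl g).hom ▷ A.X ≫ A.X ◁ μ ≫
          A.X ◁ E.coact g ≫ E.bimod.actLeft := by
      have h1 : A.X ◁ (E.coinvIncl g).hom ▷ A.X ≫ A.X ◁ μ ≫ A.X ◁ E.coact g =
          A.X ◁ (E.coinvIncl g).hom ▷ A.X ≫ A.X ◁ A.X ◁ E.coact g ≫ A.X ◁ E.bimod.actLeft := by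
        simp only [← MonoidalCategory.whiskerLeft_comp, coinvIncl_mul_coact]
      have h2 := E.bimod.left_assoc
      rw [reassoc_of% h1, ← whisker_exchange_assoc, h2]
      simp
    exact h)

theorem proj_canHom : Sweedler.proj (E.coinvIncl g) ≫ E.canHom g =
    A.X ◁ E.coact g ≫ E.bimod.actLeft :=
  Sweedler.proj_desc _ _ _

/-- `can`, as a morphism of bimodules. -/
noncomputable def canBimod : Sweedler.bimod (E.coinvIncl g) ⟶ E.bimod where
  hom := E.canHom g
  left_act_hom := by
    have h := E.bimod.left_assoc
    rw [← cancel_epi (A.X ◁ Sweedler.proj _), reassoc_of% (Sweedler.proj_actLeft (E.coinvIncl g)),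
      proj_canHom, ← MonoidalCategory.whiskerLeft_comp_assoc, proj_canHom,
      ← whisker_exchange_assoc, h]
    simp
  right_act_hom := by
    have h : A.X ◁ μ ≫ A.X ◁ E.coact g = A.X ◁ E.coact g ▷ A.X ≫ A.X ◁ E.bimod.actRight := by
      rw [← MonoidalCategory.whiskerLeft_comp, mul_coact, ← MonoidalCategory.whiskerLeft_comp]
    rw [← cancel_epi (Sweedler.proj _ ▷ A.X), reassoc_of% (Sweedler.proj_actRight (E.coinvIncl g)),
      proj_canHom, ← comp_whiskerRight_assoc, proj_canHom, reassoc_of% h,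
      comp_whiskerRight_assoc, E.bimod.middle_assoc]
    simp

theorem one_coact_eq : η ≫ E.coact g = g.hom ≫ unitC := by
  rw [one_coact, comp_unitC]

theorem inl_canHom : Sweedler.inl (E.coinvIncl g) ≫ E.canHom g =
    (ρ_ A.X).inv ≫ A.X ◁ (g.hom ≫ unitC) ≫ E.bimod.actLeft := by
  rw [Sweedler.inl, Category.assoc, Category.assoc, proj_canHom,
    ← MonoidalCategory.whiskerLeft_comp_assoc, one_coact_eq]

theorem inr_canHom : Sweedler.inr (E.coinvIncl g) ≫ E.canHom g = E.coact g := by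
  rw [Sweedler.inr, Category.assoc, Category.assoc, proj_canHom, ← whisker_exchange_assoc,
    ← leftUnitor_inv_naturality_assoc, E.bimod.one_actLeft, Iso.inv_hom_id, Category.comp_id]

theorem coact_comulHom : E.coact g ≫ E.comulHom = (λ_ A.X).inv ≫ (g.hom ≫ unitC) ▷ A.X ≫
    (A.X ⊗ C.X) ◁ E.coact g ≫ bimodProj E.bimod E.bimod := by
  have h1 : E.coact g ≫ comulAux = E.coact g ≫ E.coact g ▷ C.X := by
    rw [comulAux, reassoc_of% (E.coact_comul g), Iso.hom_inv_id, Category.comp_id]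
  have h2 : E.coact g ▷ (A.X ⊗ C.X) ≫ bimodProj E.bimod E.bimod =
      E.bimod.actLeft ≫ (λ_ (A.X ⊗ C.X)).inv ≫ (g.hom ≫ unitC) ▷ (A.X ⊗ C.X) ≫
        bimodProj E.bimod E.bimod := by
    have h := bimodProj_condition E.bimod E.bimod
    rw [coact_eq]
    rw [comp_whiskerRight, comp_whiskerRight, Category.assoc, Category.assoc]
    erw [h]
    rw [leftUnitor_inv_naturality_assoc, whisker_exchange_assoc]
    simp
  have h3 := E.unitC_actLeft =≫ ((λ_ (A.X ⊗ C.X)).inv ≫ (g.hom ≫ unitC) ▷ (A.X ⊗ C.X) ≫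
    bimodProj E.bimod E.bimod)
  rw [Category.assoc, Category.id_comp] at h3
  rw [comulHom, reassoc_of% h1, ← whisker_exchange_assoc, h2, h3, leftUnitor_inv_naturality_assoc, whisker_exchange_assoc]

/-- The canonical morphism of `A`-corings `can : A ⊗_{A^C} A ⟶ A ⊗ C`. -/
noncomputable def can : sweedlerCoring (E.coinvIncl g) ⟶ E.coring where
  hom := E.canBimod g
  counit := by
    ext
    change E.canHom g ≫ counitHom = Sweedler.counitHom _
    rw [← cancel_epi (Sweedler.proj _), ← Category.assoc, proj_canHom, Category.assoc, Sweedler.proj_counitHom,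
      actLeft_counitHom, ← MonoidalCategory.whiskerLeft_comp_assoc, coact_counitHom]
    simp
  comul := by
    change E.canHom g ≫ E.comulHom = Sweedler.comulHom _ ≫ bimodMap (E.canBimod g) (E.canBimod g)
    rw [← cancel_epi (Sweedler.proj _), ← Category.assoc, proj_canHom, Category.assoc,
      reassoc_of% (Sweedler.proj_comulHom (E.coinvIncl g)), bimodProj_map, actLeft_comulHom,
      ← MonoidalCategory.whiskerLeft_comp_assoc, coact_comulHom]
    change _ = _ ≫ _ ≫ E.canHom g ▷ _ ≫ _ ◁ E.canHom g ≫ _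
    rw [whisker_exchange_assoc, ← comp_whiskerRight_assoc, inl_canHom,
      ← MonoidalCategory.whiskerLeft_comp_assoc, inr_canHom]
    simp only [MonoidalCategory.whiskerLeft_comp, Category.assoc, bimodProj_actLeft]
    rw [associator_inv_naturality_right_assoc, whisker_exchange_assoc]
    simp

/-- `A` is `(C, g)`-Galois if `can` is an isomorphism of `A`-corings. -/
def IsGalois : Prop := IsIso (E.can g)

/-- The right `A`-module `X ⊗_{A^C} A`. -/
noncomputable abbrev induced (X : RightModule (E.coinvariants g)) : RightModule A :=
  (extensionOfScalars (E.coinvIncl g)).obj X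

/-- The canonical projection `X ⊗ A ⟶ X ⊗_{A^C} A`. -/
noncomputable def inducedProj (X : RightModule (E.coinvariants g)) :
    X.X ⊗ A.X ⟶ (E.induced g X).X :=
  X.tensorProj (leftRestrict (E.coinvIncl g))

variable (X : RightModule (E.coinvariants g))

instance : Epi (E.inducedProj g X) :=
  inferInstanceAs (Epi (X.tensorProj (leftRestrict (E.coinvIncl g))))

instance (W : V) : Epi (E.inducedProj g X ▷ W) :=
  inferInstanceAs (Epi (X.tensorProj (leftRestrict (E.coinvIncl g)) ▷ W))

theorem inducedProj_condition : X.act ▷ A.X ≫ E.inducedProj g X =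
    (α_ _ _ _).hom ≫ X.X ◁ (E.coinvIncl g).hom ▷ A.X ≫ X.X ◁ μ ≫ E.inducedProj g X := by
  have h := relTensor.condition X.act (leftRestrict (E.coinvIncl g)).actLeft
  rw [MonoidalCategory.whiskerLeft_comp, Category.assoc] at h
  exact h

theorem inducedProj_act : E.inducedProj g X ▷ A.X ≫ (E.induced g X).act =
    (α_ _ _ _).hom ≫ X.X ◁ μ ≫ E.inducedProj g X :=
  X.tensorProj_act (leftRestrict (E.coinvIncl g))

/-- The coaction `X ⊗_{A^C} A ⟶ (X ⊗_{A^C} A) ⊗ C` induced by the coaction `A ⟶ A ⊗ C`. -/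
noncomputable def inducedCoact : (E.induced g X).X ⟶ (E.induced g X).X ⊗ C.X :=
  relTensor.desc (X.X ◁ E.coact g ≫ (α_ X.X A.X C.X).inv ≫ E.inducedProj g X ▷ C.X) (by
    have h1 : X.X ◁ (E.coinvIncl g).hom ▷ A.X ≫ X.X ◁ μ ≫ X.X ◁ E.coact g =
        X.X ◁ (E.coinvIncl g).hom ▷ A.X ≫ X.X ◁ A.X ◁ E.coact g ≫ X.X ◁ E.bimod.actLeft := by
      simp only [← MonoidalCategory.whiskerLeft_comp, coinvIncl_mul_coact]
    have h2 : X.act ▷ A.X ▷ C.X ≫ E.inducedProj g X ▷ C.X =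
        ((α_ _ _ _).hom ≫ X.X ◁ (E.coinvIncl g).hom ▷ A.X ≫ X.X ◁ μ ≫ E.inducedProj g X) ▷ C.X := by
      rw [← comp_whiskerRight, inducedProj_condition]
    have h : X.act ▷ A.X ≫ X.X ◁ E.coact g ≫ (α_ X.X A.X C.X).inv ≫ E.inducedProj g X ▷ C.X =
        (α_ _ _ _).hom ≫ X.X ◁ (E.coinvIncl g).hom ▷ A.X ≫ X.X ◁ μ ≫
          X.X ◁ E.coact g ≫ (α_ X.X A.X C.X).inv ≫ E.inducedProj g X ▷ C.X := by
      rw [reassoc_of% h1, ← whisker_exchange_assoc, associator_inv_naturality_left_assoc, h2]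
      have h3 : X.X ◁ (E.coinvIncl g).hom ▷ A.X ≫ X.X ◁ A.X ◁ E.coact g =
          X.X ◁ (E.coinvariants g).X ◁ E.coact g ≫ X.X ◁ (E.coinvIncl g).hom ▷ (A.X ⊗ C.X) := by
        simp only [← MonoidalCategory.whiskerLeft_comp, whisker_exchange]
      rw [reassoc_of% h3]
      simp
    rw [MonoidalCategory.whiskerLeft_comp, Category.assoc]
    exact h)

theorem proj_inducedCoact : E.inducedProj g X ≫ E.inducedCoact g X =
    X.X ◁ E.coact g ≫ (α_ X.X A.X C.X).inv ≫ E.inducedProj g X ▷ C.X :=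
  relTensor.proj_desc _ _ _ _

/-- The entwined module `X ⊗_{A^C} A`. -/
noncomputable def inducedEntwined : EntwinedModule E where
  toRightModule := E.induced g X
  coact := E.inducedCoact g X
  coact_counit := by
    have h : X.X ◁ E.coact g ≫ X.X ◁ A.X ◁ ε[C.X] = X.X ◁ (ρ_ A.X).inv := by
      rw [← MonoidalCategory.whiskerLeft_comp, coact_counit]
    rw [← cancel_epi (E.inducedProj g X), reassoc_of% (E.proj_inducedCoact g X),
      ← whisker_exchange, tensor_whiskerLeft_assoc, Iso.inv_hom_id_assoc, reassoc_of% h]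
    simp
  coact_comul := by
    have h : X.X ◁ E.coact g ≫ X.X ◁ A.X ◁ Δ[C.X] =
        X.X ◁ (E.coact g ≫ E.coact g ▷ C.X ≫ (α_ A.X C.X C.X).hom) := by
      rw [← MonoidalCategory.whiskerLeft_comp, coact_comul]
    rw [← cancel_epi (E.inducedProj g X), reassoc_of% (E.proj_inducedCoact g X),
      reassoc_of% (E.proj_inducedCoact g X),
      ← whisker_exchange, tensor_whiskerLeft_assoc, Iso.inv_hom_id_assoc, reassoc_of% h,
      ← comp_whiskerRight_assoc, proj_inducedCoact]
    simp
  compat := by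
    have h : X.X ◁ μ ≫ X.X ◁ E.coact g = X.X ◁ (E.coact g ▷ A.X ≫ (α_ _ _ _).hom ≫
        A.X ◁ E.lam ≫ (α_ _ _ _).inv ≫ μ ▷ C.X) := by
      rw [← MonoidalCategory.whiskerLeft_comp, mul_coact]
    rw [← cancel_epi (E.inducedProj g X ▷ A.X), reassoc_of% (E.inducedProj_act g X),
      proj_inducedCoact, reassoc_of% h, ← comp_whiskerRight_assoc, proj_inducedCoact]
    simp only [comp_whiskerRight, Category.assoc]
    rw [associator_naturality_left_assoc, ← whisker_exchange_assoc,
      associator_inv_naturality_left_assoc, ← comp_whiskerRight, inducedProj_act]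
    simp

/-- The underlying morphism of `f ⊗_{A^C} A`. -/
noncomputable def inducedMap {X Y : RightModule (E.coinvariants g)} (f : X ⟶ Y) :
    (E.induced g X).X ⟶ (E.induced g Y).X :=
  ((extensionOfScalars (E.coinvIncl g)).map f).hom

theorem proj_inducedMap {X Y : RightModule (E.coinvariants g)} (f : X ⟶ Y) :
    E.inducedProj g X ≫ E.inducedMap g f = f.hom ▷ A.X ≫ E.inducedProj g Y :=
  RightModule.tensorProj_tensorMapHom f (leftRestrict (E.coinvIncl g))

theorem inducedCoact_map {X Y : RightModule (E.coinvariants g)} (f : X ⟶ Y) :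
    E.inducedCoact g X ≫ E.inducedMap g f ▷ C.X = E.inducedMap g f ≫ E.inducedCoact g Y := by
  rw [← cancel_epi (E.inducedProj g X), reassoc_of% (E.proj_inducedCoact g X),
    reassoc_of% (E.proj_inducedMap g f), proj_inducedCoact, ← comp_whiskerRight,
    proj_inducedMap, comp_whiskerRight, ← whisker_exchange_assoc]
  simp

/-- The functor `F̄` from right `A^C`-modules to entwined modules, `X ↦ X ⊗_{A^C} A`. -/
noncomputable def Fbar : RightModule (E.coinvariants g) ⥤ EntwinedModule E where
  obj X := E.inducedEntwined g X
  map {X Y} f :=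
    { (extensionOfScalars (E.coinvIncl g)).map f with
      coact_hom := E.inducedCoact_map g f }
  map_id X := by
    apply EntwinedModule.Hom.ext
    exact congrArg RightModule.Hom.hom ((extensionOfScalars (E.coinvIncl g)).map_id X)
  map_comp f h := by
    apply EntwinedModule.Hom.ext
    exact congrArg RightModule.Hom.hom ((extensionOfScalars (E.coinvIncl g)).map_comp f h)

end galois

end EntwiningStructure

end Main

end Entwine

/-! Let U be the functor from entwined modules to right A-modules that forgets the coaction. It is
comonadic: its right adjoint is M ↦ M ⊗ C, with the action of A twisted by λ, and a coalgebra for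
the resulting comonad is precisely an entwined module. Since F = U F̄ has restriction of scalars as
right adjoint, the theorem becomes a question about lifting a left adjoint along a comonadic
functor.

Such a lift induces a morphism of comonads from that of F to that of U (`liftComonadHom`);
underneath it is U applied to the mate `liftComparison` of the identity F = U F̄. The comparison
functor of F, followed by the induced functor on coalgebras, is F̄ followed by the comparison
functor of U (`comparisonLiftIso`). If the comonad morphism is invertible, two-out-of-three for
equivalences shows that F̄ is an equivalence exactly when the comparison functor of F is.
Conversely, an equivalence F̄ forces the mate to be invertible, by Yoneda. Together these give
`isEquivalence_lift_iff`.

It remains to match the mate with the Galois condition. At a right A-module M the mate is a morphism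
M ⊗_{A^C} A → M ⊗ C, in substance M ⊗_A can. For M = A it is can itself, and an inverse of can
yields an inverse for every M (`isIso_moduleCan`), so the mate is invertible if and only if A is
Galois. -/

namespace Entwine

/-! ### Lifting left adjoints along comonadic functors. -/

section Comparison

universe v₁ v₂ v₃ u₁ u₂ u₃

variable {X : Type u₁} [Category.{v₁} X] {Y : Type u₂} [Category.{v₂} Y]
  {D : Type u₃} [Category.{v₃} D]

/-- A morphism of comonads induces a functor between the categories of coalgebras. -/
@[simps]
def coalgebraFunctorOfComonadHom {G₁ G₂ : Comonad D} (h : G₁ ⟶ G₂) :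
    G₁.Coalgebra ⥤ G₂.Coalgebra where
  obj M :=
    { A := M.A
      a := M.a ≫ h.app M.A
      counit := by simp [M.counit]
      coassoc := by
        rw [Category.assoc, h.app_δ, reassoc_of% M.coassoc, Category.assoc, Functor.map_comp]
        simp only [NatTrans.naturality_assoc] }
  map {M N} f :=
    { f := f.f
      h := by
        have e := f.h =≫ h.app N.A
        rw [Category.assoc, h.naturality, ← Category.assoc, Category.assoc f.f] at e
        exact e }

/-- Isomorphic comonads have equivalent categories of coalgebras. -/
def coalgebraEquivOfIsoComonads {G₁ G₂ : Comonad D} (h : G₁ ≅ G₂) :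
    G₁.Coalgebra ≌ G₂.Coalgebra where
  functor := coalgebraFunctorOfComonadHom h.hom
  inverse := coalgebraFunctorOfComonadHom h.inv
  -- Both round trips fix carriers, so only structure maps are compared; they agree because the
  -- components of `h.hom` and `h.inv` cancel.
  unitIso := NatIso.ofComponents (fun M => Comonad.Coalgebra.isoMk (Iso.refl _) (by
    have e : h.hom.app M.A ≫ h.inv.app M.A = 𝟙 _ :=
      congrArg (fun k : G₁ ⟶ G₁ => k.app M.A) h.hom_inv_id
    have e' : M.a ≫ G₁.map (𝟙 M.A) = 𝟙 M.A ≫ (M.a ≫ h.hom.app M.A) ≫ h.inv.app M.A := by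
      rw [Category.assoc, e]
      simp
    exact e')) (by
    intro M N f
    apply Comonad.Coalgebra.Hom.ext'
    exact (Category.comp_id f.f).trans (Category.id_comp f.f).symm)
  counitIso := NatIso.ofComponents (fun M => Comonad.Coalgebra.isoMk (Iso.refl _) (by
    have e : h.inv.app M.A ≫ h.hom.app M.A = 𝟙 _ :=
      congrArg (fun k : G₂ ⟶ G₂ => k.app M.A) h.inv_hom_id
    have e' : ((M.a ≫ h.inv.app M.A) ≫ h.hom.app M.A) ≫ G₂.map (𝟙 M.A) = 𝟙 M.A ≫ M.a := by
      rw [Category.assoc M.a, e]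
      simp
    exact e')) (by
    intro M N f
    apply Comonad.Coalgebra.Hom.ext'
    exact (Category.comp_id f.f).trans (Category.id_comp f.f).symm)
  functor_unitIso_comp M := by
    apply Comonad.Coalgebra.Hom.ext'
    exact Category.comp_id (𝟙 M.A)

variable {P : X ⥤ Y} {U : Y ⥤ D} {K : D ⥤ Y} {R : D ⥤ X}

/-- For a lift `P` of a left adjoint `P ⋙ U` along a left adjoint `U`, the comparison of the
composite of `P` and the right adjoint of `P ⋙ U` with the right adjoint of `U`. -/
def liftComparison (adjU : U ⊣ K) (adj : P ⋙ U ⊣ R) : R ⋙ P ⟶ K where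
  app M := adjU.unit.app (P.obj (R.obj M)) ≫ K.map (adj.counit.app M)
  naturality M N f := by
    have h : adj.counit.app M ≫ f = (P ⋙ U).map (R.map f) ≫ adj.counit.app N :=
      (adj.counit_naturality f).symm
    rw [Category.assoc, ← K.map_comp, h, K.map_comp]
    exact (adjU.unit_naturality_assoc (P.map (R.map f)) _).symm

variable (adjU : U ⊣ K) (adj : P ⋙ U ⊣ R)

/-- A triangle identity of `adjU`: the component of the mate is the transpose of the counit of
`adj`. This is the counit law of the comonad morphism below. -/
theorem map_liftComparison_counit (M : D) :
    U.map ((liftComparison adjU adj).app M) ≫ adjU.counit.app M = adj.counit.app M := by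
  simp [liftComparison]

/-- Naturality of the unit of `adjU` reduces this to a triangle identity of `adj`. Both the
comultiplication law of the comonad morphism and the agreement of the two comparison functors are
images of this identity under U. -/
theorem map_unit_liftComparison (Z : X) :
    P.map (adj.unit.app Z) ≫ (liftComparison adjU adj).app (U.obj (P.obj Z)) =
      adjU.unit.app (P.obj Z) := by
  have h := adj.left_triangle_components Z
  change P.map _ ≫ adjU.unit.app _ ≫ K.map _ = _
  have h2 := adjU.unit_naturality_assoc (P.map (adj.unit.app Z))
    (K.map (adj.counit.app (U.obj (P.obj Z))))
  refine h2.symm.trans ?_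
  rw [← K.map_comp]
  refine (congrArg (fun k => _ ≫ K.map k) h).trans ?_
  simp

/-- The morphism of comonads induced by `liftComparison`. -/
def liftComonadHom : adj.toComonad ⟶ adjU.toComonad where
  app M := U.map ((liftComparison adjU adj).app M)
  naturality M N f := by
    have h := (liftComparison adjU adj).naturality f
    have h' := congrArg U.map h
    rw [U.map_comp, U.map_comp] at h'
    exact h'
  app_ε M := map_liftComparison_counit adjU adj M
  app_δ M := by
    -- The unit identity is taken at `R.obj M` and followed by K U of the mate; naturality of the
    -- unit of `adjU` then moves the mate to the front.
    have h := (map_unit_liftComparison adjU adj (R.obj M) =≫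
      K.map (U.map ((liftComparison adjU adj).app M))).trans
      (adjU.unit_naturality ((liftComparison adjU adj).app M))
    have h' := congrArg U.map h
    simp only [U.map_comp, Category.assoc] at h'
    exact h'.symm

/-- The comparison functor of `P ⋙ U`, followed by the functor between categories of coalgebras
induced by `liftComparison`, is `P` followed by the comparison functor of `U`. -/
def comparisonLiftIso :
    Comonad.comparison adj ⋙ coalgebraFunctorOfComonadHom (liftComonadHom adjU adj) ≅
      P ⋙ Comonad.comparison adjU :=
  NatIso.ofComponents (fun Z => Comonad.Coalgebra.isoMk (Iso.refl _) (by
    -- Both coalgebras have carrier U P Z, so it is enough that their structure maps coincide.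
    have h := congrArg U.map (map_unit_liftComparison adjU adj Z)
    rw [U.map_comp] at h
    have h2 : ((Comonad.comparison adj ⋙
        coalgebraFunctorOfComonadHom (liftComonadHom adjU adj)).obj Z).a =
          ((P ⋙ Comonad.comparison adjU).obj Z).a := h
    simp only [Iso.refl_hom]
    rw [h2]
    refine (congrArg (fun k => _ ≫ k) (adjU.toComonad.map_id _)).trans ?_
    exact (Category.comp_id _).trans (Category.id_comp _).symm)) (by
    intro Z W f
    apply Comonad.Coalgebra.Hom.ext'
    exact (Category.comp_id _).trans (Category.id_comp _).symm)

/-- When P is an equivalence, both R followed by P and K represent the functor N ↦ D(U N, M), and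
the mate is the comparison of the two representing objects. Yoneda concludes. -/
theorem isIso_liftComparison [P.IsEquivalence] : IsIso (liftComparison adjU adj) := by
  have (M : D) : IsIso ((liftComparison adjU adj).app M) := by
    have bij (N : Y) : Function.Bijective
        (fun f : N ⟶ P.obj (R.obj M) => f ≫ (liftComparison adjU adj).app M) := by
      have key (Z : X) (f : Z ⟶ R.obj M) : P.map f ≫ (liftComparison adjU adj).app M =
          adjU.homEquiv _ _ ((adj.homEquiv Z M).symm f) := by
        rw [adjU.homEquiv_unit, adj.homEquiv_counit, K.map_comp]
        exact (adjU.unit_naturality_assoc (P.map f) _).symm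
      -- On morphisms out of P Z, composing with the mate is the chain of bijections Y(P Z, P R M) ≅
      -- X(Z, R M) ≅ D(U P Z, M) ≅ Y(P Z, K M), the first by full faithfulness of P.
      have bij' (Z : X) : Function.Bijective
          (fun f : P.obj Z ⟶ P.obj (R.obj M) => f ≫ (liftComparison adjU adj).app M) := by
        have e : (fun f : P.obj Z ⟶ P.obj (R.obj M) => f ≫ (liftComparison adjU adj).app M) =
            (((Functor.FullyFaithful.ofFullyFaithful P).homEquiv (X := Z)
              (Y := R.obj M)).symm.trans ((adj.homEquiv Z M).symm.trans
                (adjU.homEquiv (P.obj Z) M))) := by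
          funext f
          obtain ⟨f, rfl⟩ := P.map_surjective f
          refine (key Z f).trans ?_
          have : (Functor.FullyFaithful.ofFullyFaithful P).homEquiv.symm (P.map f) = f :=
            Equiv.symm_apply_apply _ f
          simp only [Equiv.trans_apply, this]
        rw [e]
        exact Equiv.bijective _
      -- Essential surjectivity transports the bijection from objects P Z to an arbitrary N.
      let i := P.objObjPreimageIso N
      constructor
      · intro f f' h
        rw [← cancel_epi i.hom]
        apply (bij' _).1
        simpa using h
      · intro f
        obtain ⟨f', h⟩ := (bij' _).2 (i.hom ≫ f)
        refine ⟨i.inv ≫ f', ?_⟩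
        simpa using congrArg (fun k => i.inv ≫ k) h
    exact isIso_of_yoneda_map_bijective _ bij
  exact NatIso.isIso_of_isIso_app _

/-- In the square of `comparisonLiftIso`, the functor between coalgebra categories and the
comparison functor of U are equivalences, so the other two sides are equivalences simultaneously. -/
theorem isEquivalence_comparison_iff_lift [(Comonad.comparison adjU).IsEquivalence]
    [IsIso (liftComparison adjU adj)] :
    (Comonad.comparison adj).IsEquivalence ↔ P.IsEquivalence := by
  -- The natural transformation underlying the comonad morphism is the mate whiskered with U, and a
  -- comonad morphism is invertible as soon as its underlying transformation is.
  have hw : IsIso (Functor.whiskerRight (liftComparison adjU adj) U) :=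
    (Functor.isoWhiskerRight (asIso (liftComparison adjU adj)) U).isIso_hom
  have : IsIso ((comonadToFunctor D).map (liftComonadHom adjU adj)) := hw
  have : IsIso (liftComonadHom adjU adj) := isIso_of_reflects_iso _ (comonadToFunctor D)
  have : (coalgebraFunctorOfComonadHom (liftComonadHom adjU adj)).IsEquivalence :=
    (coalgebraEquivOfIsoComonads (asIso (liftComonadHom adjU adj))).isEquivalence_functor
  constructor
  · intro
    have := Functor.isEquivalence_of_iso (comparisonLiftIso adjU adj)
    exact Functor.isEquivalence_of_comp_right P (Comonad.comparison adjU)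
  · intro
    have := Functor.isEquivalence_of_iso (comparisonLiftIso adjU adj).symm
    exact Functor.isEquivalence_of_comp_right (Comonad.comparison adj)
      (coalgebraFunctorOfComonadHom (liftComonadHom adjU adj))

/-- Comonadicity supplies a right adjoint of its own, which need not be the chosen R. Mates for the
two choices differ by the canonical isomorphism of right adjoints, so invertibility does not depend
on the choice. -/
theorem liftComparison_app_eq_of_adjunction {R' : D ⥤ X} (adj' : P ⋙ U ⊣ R') (M : D) :
    (liftComparison adjU adj').app M =
      P.map ((adj'.rightAdjointUniq adj).hom.app M) ≫ (liftComparison adjU adj).app M := by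
  have h := Adjunction.rightAdjointUniq_hom_app_counit adj' adj M
  change adjU.unit.app _ ≫ K.map _ = _ ≫ adjU.unit.app _ ≫ K.map _
  rw [← h, K.map_comp]
  exact (adjU.unit_naturality_assoc (P.map ((adj'.rightAdjointUniq adj).hom.app M)) _)

theorem isIso_liftComparison_of_adjunction {R' : D ⥤ X} (adj' : P ⋙ U ⊣ R')
    [IsIso (liftComparison adjU adj)] : IsIso (liftComparison adjU adj') := by
  have (M : D) : IsIso ((liftComparison adjU adj').app M) := by
    rw [liftComparison_app_eq_of_adjunction adjU adj adj']
    infer_instance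
  exact NatIso.isIso_of_isIso_app _

/-- A lift `P` of a left adjoint functor along a comonadic functor is an equivalence if and only if
the functor it lifts is comonadic and the comparison of right adjoints is invertible. -/
theorem isEquivalence_lift_iff [(Comonad.comparison adjU).IsEquivalence] :
    P.IsEquivalence ↔
      IsIso (liftComparison adjU adj) ∧ Nonempty (ComonadicLeftAdjoint (P ⋙ U)) := by
  constructor
  · intro
    have := isIso_liftComparison adjU adj
    exact ⟨this, ⟨⟨R, adj, (isEquivalence_comparison_iff_lift adjU adj).2 inferInstance⟩⟩⟩
  · rintro ⟨_, ⟨R', adj', h⟩⟩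
    have := isIso_liftComparison_of_adjunction adjU adj adj'
    exact (isEquivalence_comparison_iff_lift adjU adj').1 h

end Comparison

end Entwine
namespace Entwine

/-! ### Cofree entwined modules and comonadicity over right modules. -/

section Cofree

variable {V : Type u} [Category.{v} V] [MonoidalCategory V] {C : Comon V} {A : Mon V}

namespace EntwinedModule

variable {E : EntwiningStructure C A}

@[ext]
theorem hom_ext {M N : EntwinedModule E} (f g : M ⟶ N) (h : f.hom = g.hom) : f = g :=
  Hom.ext h

/-- The inverse of an invertible linear and colinear morphism is again linear and colinear. Hence
invertibility of the mate can be tested in V. -/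
theorem isIso_of_isIso_hom {M N : EntwinedModule E} (f : M ⟶ N) (h : IsIso f.hom) : IsIso f := by
  refine ⟨{ hom := inv f.hom, act_hom := ?_, coact_hom := ?_ }, ?_, ?_⟩
  · rw [IsIso.comp_inv_eq, Category.assoc, f.act_hom, ← comp_whiskerRight_assoc,
      IsIso.inv_hom_id, id_whiskerRight, Category.id_comp]
  · rw [IsIso.eq_inv_comp, ← reassoc_of% f.coact_hom, ← comp_whiskerRight, IsIso.hom_inv_id,
      id_whiskerRight, Category.comp_id]
  · ext
    exact IsIso.hom_inv_id f.hom
  · ext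
    exact IsIso.inv_hom_id f.hom

variable (E) in
/-- The functor from entwined modules to right modules which forgets the coaction. -/
@[simps]
def forget : EntwinedModule E ⥤ RightModule A where
  obj M := M.toRightModule
  map f := f.toHom

/-- The cofree entwined module `M ⊗ C` on a right module `M`. -/
@[simps]
def cofreeObj (E : EntwiningStructure C A) (M : RightModule A) : EntwinedModule E where
  X := M.X ⊗ C.X
  act := (α_ _ _ _).hom ≫ M.X ◁ E.lam ≫ (α_ _ _ _).inv ≫ M.act ▷ C.X
  -- The unit and multiplication axioms of λ give the module laws and its comultiplication axiom
  -- gives `compat`; the remaining counit axiom makes the counit of the adjunction linear.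
  act_one := by
    rw [tensor_whiskerLeft_assoc, Iso.inv_hom_id_assoc,
      ← MonoidalCategory.whiskerLeft_comp_assoc, E.lam_one]
    simp only [MonoidalCategory.whiskerLeft_comp, Category.assoc]
    rw [associator_inv_naturality_middle_assoc, ← comp_whiskerRight, M.act_one]
    simp
  act_mul := by
    have h : (α_ _ _ _).inv ≫ (α_ _ _ _).inv ≫ M.act ▷ A.X ▷ C.X ≫ M.act ▷ C.X =
        M.X ◁ (α_ _ _ _).inv ≫ M.X ◁ μ ▷ C.X ≫ (α_ _ _ _).inv ≫ M.act ▷ C.X := by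
      have h' : (α_ _ _ _).hom ≫ M.X ◁ μ[A.X] ≫ M.act = M.act ▷ A.X ≫ M.act := by
        rw [M.act_mul, Iso.hom_inv_id_assoc]
      rw [← comp_whiskerRight, ← h']
      simp
    rw [tensor_whiskerLeft_assoc, Iso.inv_hom_id_assoc,
      ← MonoidalCategory.whiskerLeft_comp_assoc, E.lam_mul]
    simp only [MonoidalCategory.whiskerLeft_comp, Category.assoc, comp_whiskerRight]
    rw [associator_naturality_left_assoc, ← whisker_exchange_assoc]
    simp [h]
  coact := M.X ◁ Δ ≫ (α_ _ _ _).inv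
  coact_counit := by
    have h : M.X ◁ Δ[C.X] ≫ M.X ◁ C.X ◁ ε[C.X] = M.X ◁ (ρ_ C.X).inv := by
      rw [← MonoidalCategory.whiskerLeft_comp, ComonObj.comul_counit]
    simp [reassoc_of% h]
  coact_comul := by
    have h : M.X ◁ Δ[C.X] ≫ M.X ◁ C.X ◁ Δ[C.X] = M.X ◁ (Δ[C.X] ≫ Δ[C.X] ▷ C.X ≫
        (α_ _ _ _).hom) := by
      rw [← MonoidalCategory.whiskerLeft_comp, ComonObj.comul_assoc]
    simp only [Category.assoc, comp_whiskerRight, tensor_whiskerLeft, Iso.inv_hom_id_assoc]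
    rw [reassoc_of% h]
    simp
  compat := by
    have h : M.X ◁ E.lam ≫ M.X ◁ A.X ◁ Δ[C.X] =
        M.X ◁ (Δ[C.X] ▷ A.X ≫ (α_ _ _ _).hom ≫ C.X ◁ E.lam ≫
          (α_ _ _ _).inv ≫ E.lam ▷ C.X ≫ (α_ _ _ _).hom) := by
      rw [← MonoidalCategory.whiskerLeft_comp, E.lam_comul]
    simp only [Category.assoc]
    rw [← whisker_exchange_assoc, tensor_whiskerLeft_assoc, Iso.inv_hom_id_assoc, reassoc_of% h]
    simp

/-- The functor sending a right module `M` to the cofree entwined module `M ⊗ C`. -/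
@[simps]
def cofree (E : EntwiningStructure C A) : RightModule A ⥤ EntwinedModule E where
  obj M := cofreeObj E M
  map {M N} f :=
    { hom := f.hom ▷ C.X
      act_hom := by
        have h : ((α_ _ _ _).hom ≫ M.X ◁ E.lam ≫ (α_ _ _ _).inv ≫ M.act ▷ C.X) ≫ f.hom ▷ C.X =
            f.hom ▷ C.X ▷ A.X ≫ (α_ _ _ _).hom ≫ N.X ◁ E.lam ≫ (α_ _ _ _).inv ≫
              N.act ▷ C.X := by
          simp only [Category.assoc]
          rw [← comp_whiskerRight, f.act_hom, associator_naturality_left_assoc,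
            ← whisker_exchange_assoc]
          simp
        exact h
      coact_hom := by
        have h : (M.X ◁ Δ[C.X] ≫ (α_ _ _ _).inv) ≫ f.hom ▷ C.X ▷ C.X =
            f.hom ▷ C.X ≫ N.X ◁ Δ[C.X] ≫ (α_ _ _ _).inv := by
          rw [← whisker_exchange_assoc]
          simp
        exact h }
  map_id M := by
    ext
    exact id_whiskerRight _ _
  map_comp f g := by
    ext
    exact comp_whiskerRight _ _ _

/-- The functor forgetting the coaction is left adjoint to the cofree entwined module functor. -/
def forgetAdjCofree (E : EntwiningStructure C A) : forget E ⊣ cofree E where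
  unit :=
    { app := fun M =>
        { hom := M.coact
          -- The entwining condition says exactly that the coaction is A-linear into the cofree
          -- module.
          act_hom := M.compat
          coact_hom := by
            have h : M.coact ≫ M.coact ▷ C.X = M.coact ≫ M.X ◁ Δ ≫ (α_ _ _ _).inv := by
              rw [reassoc_of% M.coact_comul, Iso.hom_inv_id, Category.comp_id]
            exact h }
      naturality := fun M N f => by
        ext
        exact f.coact_hom.symm }
  counit :=
    { app := fun M =>
        { hom := M.X ◁ ε ≫ (ρ_ M.X).hom
          act_hom := by
            have h : M.X ◁ E.lam ≫ M.X ◁ A.X ◁ ε[C.X] =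
                M.X ◁ (ε[C.X] ▷ A.X ≫ (λ_ A.X).hom ≫ (ρ_ A.X).inv) := by
              rw [← MonoidalCategory.whiskerLeft_comp, E.lam_counit]
            change ((α_ _ _ _).hom ≫ M.X ◁ E.lam ≫ (α_ _ _ _).inv ≫ M.act ▷ C.X) ≫
              M.X ◁ ε[C.X] ≫ (ρ_ M.X).hom = (M.X ◁ ε[C.X] ≫ (ρ_ M.X).hom) ▷ A.X ≫ M.act
            simp only [Category.assoc]
            rw [← whisker_exchange_assoc, tensor_whiskerLeft_assoc, Iso.inv_hom_id_assoc,
              reassoc_of% h]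
            simp }
      naturality := fun M N f => by
        ext
        change f.hom ▷ C.X ≫ N.X ◁ ε ≫ (ρ_ N.X).hom = (M.X ◁ ε ≫ (ρ_ M.X).hom) ≫ f.hom
        rw [← whisker_exchange_assoc]
        simp }
  left_triangle_components M := by
    ext
    change M.coact ≫ M.X ◁ ε ≫ (ρ_ M.X).hom = 𝟙 M.X
    rw [reassoc_of% M.coact_counit, Iso.inv_hom_id]
  right_triangle_components M := by
    ext
    change (M.X ◁ Δ ≫ (α_ _ _ _).inv) ≫ (M.X ◁ ε ≫ (ρ_ M.X).hom) ▷ C.X = 𝟙 (M.X ⊗ C.X)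
    have h : M.X ◁ Δ[C.X] ≫ M.X ◁ ε[C.X] ▷ C.X = M.X ◁ (λ_ C.X).inv := by
      rw [← MonoidalCategory.whiskerLeft_comp, ComonObj.counit_comul]
    simp [reassoc_of% h]

/-- Entwined modules are comonadic over right modules. -/
instance (E : EntwiningStructure C A) :
    (Comonad.comparison (forgetAdjCofree E)).IsEquivalence where
  faithful := ⟨fun {M N f g} h => by
    ext
    exact congrArg (fun k => RightModule.Hom.hom (Comonad.Coalgebra.Hom.f k)) h⟩
  full := ⟨fun {M N} f =>
    ⟨{ f.f with
        coact_hom := congrArg RightModule.Hom.hom f.h }, rfl⟩⟩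
  essSurj := ⟨fun M => by
    -- The counit and coassociativity laws of the coalgebra are, on underlying objects, the comodule
    -- laws; linearity of its structure map is the entwining condition.
    let a : M.A.X ⟶ M.A.X ⊗ C.X := M.a.hom
    have hc : a ≫ M.A.X ◁ ε ≫ (ρ_ M.A.X).hom = 𝟙 M.A.X :=
      congrArg RightModule.Hom.hom M.counit
    have hd : a ≫ M.A.X ◁ Δ ≫ (α_ _ _ _).inv = a ≫ a ▷ C.X :=
      congrArg RightModule.Hom.hom M.coassoc
    let N : EntwinedModule E :=
      { M.A with
        coact := a
        coact_counit := by
          rw [← cancel_mono (ρ_ M.A.X).hom, Category.assoc, hc, Iso.inv_hom_id]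
        coact_comul := by
          rw [← reassoc_of% hd, Iso.inv_hom_id, Category.comp_id]
        compat := M.a.act_hom }
    refine ⟨N, ⟨Comonad.Coalgebra.isoMk (Iso.refl M.A) ?_⟩⟩
    have h : M.a ≫ ((forgetAdjCofree E).toComonad).map (𝟙 M.A) = 𝟙 M.A ≫ M.a := by simp
    exact h⟩

end EntwinedModule

end Cofree

/-! ### Restriction of scalars as right adjoint of extension of scalars. -/

section Restriction

variable {V : Type u} [Category.{v} V] [MonoidalCategory V] {A B : Mon V}

/-- The restriction-of-scalars functor along an algebra morphism `i : B ⟶ A`. -/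
@[simps]
def restrictionOfScalars (i : B ⟶ A) : RightModule A ⥤ RightModule B where
  obj M :=
    { X := M.X
      act := M.X ◁ i.hom ≫ M.act
      act_one := by
        rw [← MonoidalCategory.whiskerLeft_comp_assoc, IsMonHom.one_hom, M.act_one]
      act_mul := by
        rw [← MonoidalCategory.whiskerLeft_comp_assoc, IsMonHom.mul_hom,
          MonoidalCategory.whiskerLeft_comp_assoc, M.act_mul, comp_whiskerRight, Category.assoc,
          ← whisker_exchange_assoc, MonoidalCategory.tensorHom_def]
        simp }
  map {M N} f :=
    { hom := f.hom
      act_hom := by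
        have h : (M.X ◁ i.hom ≫ M.act) ≫ f.hom = f.hom ▷ B.X ≫ N.X ◁ i.hom ≫ N.act := by
          rw [Category.assoc, f.act_hom, whisker_exchange_assoc]
        exact h }

variable [HasCoequalizers V]
  [∀ W : V, PreservesColimitsOfShape WalkingParallelPair (tensorRight W)]

variable (i : B ⟶ A)

/-- The canonical projection `X ⊗ A ⟶ X ⊗_B A`. -/
noncomputable def extensionProj (X : RightModule B) :
    X.X ⊗ A.X ⟶ ((extensionOfScalars i).obj X).X :=
  X.tensorProj (leftRestrict i)

instance (X : RightModule B) : Epi (extensionProj i X) :=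
  inferInstanceAs (Epi (X.tensorProj (leftRestrict i)))

instance (X : RightModule B) (W : V) : Epi (extensionProj i X ▷ W) :=
  inferInstanceAs (Epi (X.tensorProj (leftRestrict i) ▷ W))

theorem extensionProj_act (X : RightModule B) :
    extensionProj i X ▷ A.X ≫ ((extensionOfScalars i).obj X).act =
      (α_ _ _ _).hom ≫ X.X ◁ μ ≫ extensionProj i X :=
  X.tensorProj_act (leftRestrict i)

theorem extensionProj_condition (X : RightModule B) : X.act ▷ A.X ≫ extensionProj i X =
    (α_ _ _ _).hom ≫ X.X ◁ i.hom ▷ A.X ≫ X.X ◁ μ ≫ extensionProj i X := by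
  have h := relTensor.condition X.act (leftRestrict i).actLeft
  rw [MonoidalCategory.whiskerLeft_comp, Category.assoc] at h
  exact h

theorem extensionProj_map {X Y : RightModule B} (f : X ⟶ Y) :
    extensionProj i X ≫ ((extensionOfScalars i).map f).hom = f.hom ▷ A.X ≫ extensionProj i Y :=
  RightModule.tensorProj_tensorMapHom f (leftRestrict i)

/-- The morphism `x ↦ x ⊗_B 1`. -/
noncomputable def extensionUnit (X : RightModule B) : X.X ⟶ ((extensionOfScalars i).obj X).X :=
  (ρ_ X.X).inv ≫ X.X ◁ η ≫ extensionProj i X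

/-- In elements, (x ⊗ 1) a = x ⊗ a, so X ⊗_B A is generated over A by the image of the unit. This
gives one triangle identity. -/
theorem extensionUnit_act (X : RightModule B) :
    extensionUnit i X ▷ A.X ≫ ((extensionOfScalars i).obj X).act = extensionProj i X := by
  simp only [extensionUnit, comp_whiskerRight, Category.assoc, extensionProj_act, whisker_assoc,
    Iso.inv_hom_id_assoc]
  rw [← MonoidalCategory.whiskerLeft_comp_assoc, MonObj.one_mul]
  simp

/-- Balancing over B turns x b ⊗ 1 into x ⊗ i(b). With `extensionUnit_act` this makes the unit
B-linear. -/
theorem act_extensionUnit (X : RightModule B) :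
    X.act ≫ extensionUnit i X = X.X ◁ i.hom ≫ extensionProj i X := by
  have h : i.hom ▷ 𝟙_ V ≫ A.X ◁ η ≫ μ = (ρ_ _).hom ≫ i.hom := by
    rw [MonObj.mul_one]
    simp
  have h' : (ρ_ (X.X ⊗ B.X)).inv ≫ (α_ _ _ _).hom ≫ X.X ◁ B.X ◁ η ≫ X.X ◁ i.hom ▷ A.X ≫
      X.X ◁ μ = X.X ◁ i.hom := by
    rw [← MonoidalCategory.whiskerLeft_comp_assoc, whisker_exchange,
      ← MonoidalCategory.whiskerLeft_comp, Category.assoc, h]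
    simp
  rw [extensionUnit, rightUnitor_inv_naturality_assoc, ← whisker_exchange_assoc,
    extensionProj_condition, tensor_whiskerLeft_assoc, Iso.inv_hom_id_assoc, reassoc_of% h']

/-- The canonical projection `M ⊗ A ⟶ M ⊗_B A` for a right `A`-module `M`. -/
noncomputable def restrictedProj (M : RightModule A) :
    M.X ⊗ A.X ⟶ ((extensionOfScalars i).obj ((restrictionOfScalars i).obj M)).X :=
  extensionProj i ((restrictionOfScalars i).obj M)

instance (M : RightModule A) : Epi (restrictedProj i M) :=
  inferInstanceAs (Epi (extensionProj i ((restrictionOfScalars i).obj M)))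

theorem restrictedProj_condition (M : RightModule A) :
    (M.X ◁ i.hom ≫ M.act) ▷ A.X ≫ restrictedProj i M =
      (α_ _ _ _).hom ≫ M.X ◁ i.hom ▷ A.X ≫ M.X ◁ μ ≫ restrictedProj i M :=
  extensionProj_condition i ((restrictionOfScalars i).obj M)

/-- The unit `X ⟶ X ⊗_B A`, as a morphism of right `B`-modules. -/
noncomputable def extensionUnitHom (X : RightModule B) :
    X ⟶ (restrictionOfScalars i).obj ((extensionOfScalars i).obj X) where
  hom := extensionUnit i X
  act_hom := by
    have h : X.act ≫ extensionUnit i X =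
        extensionUnit i X ▷ B.X ≫ ((extensionOfScalars i).obj X).X ◁ i.hom ≫
          ((extensionOfScalars i).obj X).act := by
      rw [act_extensionUnit, ← whisker_exchange_assoc, extensionUnit_act]
    exact h

/-- The morphism `M ⊗_B A ⟶ M` induced by the action of `A` on `M`. -/
noncomputable def extensionCounit (M : RightModule A) :
    ((extensionOfScalars i).obj ((restrictionOfScalars i).obj M)).X ⟶ M.X :=
  relTensor.desc M.act (by
    have h : (α_ _ _ _).hom ≫ M.X ◁ μ[A.X] ≫ M.act = M.act ▷ A.X ≫ M.act := by
      rw [M.act_mul, Iso.hom_inv_id_assoc]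
    have h' : (M.X ◁ i.hom ≫ M.act) ▷ A.X ≫ M.act =
      (α_ _ _ _).hom ≫ M.X ◁ (i.hom ▷ A.X ≫ μ) ≫ M.act := by
      rw [comp_whiskerRight_assoc, ← h]
      simp
    exact h')

theorem extensionProj_counit (M : RightModule A) :
    extensionProj i ((restrictionOfScalars i).obj M) ≫ extensionCounit i M = M.act :=
  relTensor.proj_desc _ _ _ _

/-- The counit `M ⊗_B A ⟶ M`, as a morphism of right `A`-modules. -/
noncomputable def extensionCounitHom (M : RightModule A) :
    (extensionOfScalars i).obj ((restrictionOfScalars i).obj M) ⟶ M where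
  hom := extensionCounit i M
  act_hom := by
    have h : (α_ _ _ _).hom ≫ M.X ◁ μ[A.X] ≫ M.act = M.act ▷ A.X ≫ M.act := by
      rw [M.act_mul, Iso.hom_inv_id_assoc]
    rw [← cancel_epi (extensionProj i ((restrictionOfScalars i).obj M) ▷ A.X),
      reassoc_of% (extensionProj_act i ((restrictionOfScalars i).obj M)),
      ← comp_whiskerRight_assoc, extensionProj_counit]
    exact h

/-- Extension of scalars is left adjoint to restriction of scalars. -/
noncomputable def extensionAdjRestriction : extensionOfScalars i ⊣ restrictionOfScalars i where
  unit :=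
    { app := extensionUnitHom i
      naturality := fun X Y f => by
        ext
        change f.hom ≫ extensionUnit i Y = extensionUnit i X ≫ ((extensionOfScalars i).map f).hom
        simp only [extensionUnit, Category.assoc, extensionProj_map]
        rw [rightUnitor_inv_naturality_assoc, whisker_exchange_assoc] }
  counit :=
    { app := extensionCounitHom i
      naturality := fun M N f => by
        ext
        rw [← cancel_epi (extensionProj i ((restrictionOfScalars i).obj M))]
        have h := extensionProj_map i ((restrictionOfScalars i).map f) =≫ extensionCounit i N
        rw [Category.assoc, Category.assoc, extensionProj_counit] at h
        have h' := extensionProj_counit i M =≫ f.hom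
        rw [Category.assoc] at h'
        exact h.trans (f.act_hom.symm.trans h'.symm) }
  left_triangle_components X := by
    ext
    rw [← cancel_epi (extensionProj i X)]
    -- On x ⊗ a the triangle composite is (x ⊗ 1) a, which is x ⊗ a.
    have h := extensionProj_map i (extensionUnitHom i X) =≫
      extensionCounit i ((extensionOfScalars i).obj X)
    rw [Category.assoc, Category.assoc, extensionProj_counit] at h
    exact (h.trans (extensionUnit_act i X)).trans (Category.comp_id _).symm
  right_triangle_components M := by
    ext
    change extensionUnit i ((restrictionOfScalars i).obj M) ≫ extensionCounit i M = 𝟙 M.X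
    rw [extensionUnit, Category.assoc, Category.assoc, extensionProj_counit]
    have h : (ρ_ M.X).inv ≫ M.X ◁ η[A.X] ≫ M.act = 𝟙 M.X := by
      rw [M.act_one, Iso.inv_hom_id]
    exact h

end Restriction

end Entwine
namespace Entwine

variable {V : Type u} [Category.{v} V] [MonoidalCategory V]

/-- The regular right module of an algebra. -/
@[simps]
def RightModule.regular (A : Mon V) : RightModule A where
  X := A.X
  act := μ
  act_one := MonObj.mul_one _
  act_mul := by simp

/-! ### Isomorphisms of corings. -/

section CoringIso

variable [HasCoequalizers V]
  [∀ W : V, PreservesColimitsOfShape WalkingParallelPair (tensorLeft W)]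
  [∀ W : V, PreservesColimitsOfShape WalkingParallelPair (tensorRight W)] {A : Mon V}

/-- The inverse in V is a bimodule morphism, and it respects the comultiplications because f ⊗_A f
is inverted by the tensor square of that inverse. -/
theorem Coring.isIso_of_isIso_hom {K L : Coring A} (f : K ⟶ L) (h : IsIso f.hom.hom) :
    IsIso f := by
  let e : K.M ≅ L.M :=
    Bimod.isoOfIso (@asIso _ _ _ _ f.hom.hom h) f.hom.left_act_hom f.hom.right_act_hom
  have he : e.hom = f.hom := rfl
  have hinv : e.inv.hom ≫ e.hom.hom = 𝟙 _ := congrArg Bimod.Hom.hom e.inv_hom_id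
  have hhom : e.hom.hom ≫ e.inv.hom = 𝟙 _ := congrArg Bimod.Hom.hom e.hom_inv_id
  have h1 : bimodMap e.hom e.hom ≫ bimodMap e.inv e.inv = 𝟙 _ := by
    rw [← cancel_epi (bimodProj _ _), reassoc_of% (bimodProj_map e.hom e.hom), bimodProj_map,
      whisker_exchange_assoc, ← comp_whiskerRight_assoc, hhom, id_whiskerRight, Category.id_comp,
      ← MonoidalCategory.whiskerLeft_comp_assoc, hhom, MonoidalCategory.whiskerLeft_id,
      Category.id_comp, Category.comp_id]
  refine ⟨⟨e.inv, ?_, ?_⟩, ?_, ?_⟩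
  · rw [← f.counit, ← he, e.inv_hom_id_assoc]
  · have h2 := f.comul
    rw [← he] at h2
    rw [← Category.id_comp L.comul.hom, ← hinv, Category.assoc, Category.assoc, reassoc_of% h2, h1,
      Category.comp_id]
  · exact Coring.Hom.ext e.hom_inv_id
  · exact Coring.Hom.ext e.inv_hom_id

end CoringIso

/-! ### The Galois condition as invertibility of the comparison of comonads. -/

namespace EntwiningStructure

variable [HasEqualizers V] [HasCoequalizers V]
  [∀ W : V, PreservesColimitsOfShape WalkingParallelPair (tensorLeft W)]
  [∀ W : V, PreservesColimitsOfShape WalkingParallelPair (tensorRight W)]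
  {C : Comon V} {A : Mon V} (E : EntwiningStructure C A) (g : GroupLike C)

/-- `F̄` followed by the functor forgetting the coaction is left adjoint to restriction of
scalars. -/
noncomputable def FbarForgetAdj :
    E.Fbar g ⋙ EntwinedModule.forget E ⊣ restrictionOfScalars (E.coinvIncl g) :=
  -- Forgetting the coaction of F̄(X) returns F(X) by definition.
  extensionAdjRestriction (E.coinvIncl g)

/-- The morphism `M ⊗_{A^C} A ⟶ M ⊗ C` for a right `A`-module `M`, induced by the coaction of
`A` and the action on `M`. -/
noncomputable def moduleCan (M : RightModule A) :
    (E.induced g ((restrictionOfScalars (E.coinvIncl g)).obj M)).X ⟶ M.X ⊗ C.X :=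
  E.inducedCoact g _ ≫ extensionCounit (E.coinvIncl g) M ▷ C.X

/-- In elements, m ⊗ a ↦ m a₀ ⊗ a₁, where a₀ ⊗ a₁ is the coaction of a. The projection is an
epimorphism, so this formula determines `moduleCan`. -/
theorem proj_moduleCan (M : RightModule A) :
    restrictedProj (E.coinvIncl g) M ≫
      E.moduleCan g M = M.X ◁ E.coact g ≫ (α_ _ _ _).inv ≫ M.act ▷ C.X := by
  have h := E.proj_inducedCoact g ((restrictionOfScalars (E.coinvIncl g)).obj M) =≫
    extensionCounit (E.coinvIncl g) M ▷ C.X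
  simp only [Category.assoc, ← comp_whiskerRight] at h
  have h' : E.inducedProj g ((restrictionOfScalars (E.coinvIncl g)).obj M) ≫
    extensionCounit (E.coinvIncl g) M = M.act := extensionProj_counit _ M
  rw [h'] at h
  exact h

/-- `can` is the morphism `moduleCan` for the regular module. -/
theorem canHom_eq_moduleCan : E.canHom g = E.moduleCan g (RightModule.regular A) := by
  -- A ⊗_{A^C} A and the module induced from the restriction of A have the same carrier by
  -- definition, with the same projection from A ⊗ A.
  refine (cancel_epi (Sweedler.proj (E.coinvIncl g))).1 ?_
  exact (E.proj_canHom g).trans (E.proj_moduleCan g (RightModule.regular A)).symm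

/-- The coring structure plays no further part: being Galois can be checked on the underlying
morphism in V. -/
theorem isGalois_iff_isIso_canHom : E.IsGalois g ↔ IsIso (E.canHom g) := by
  constructor
  · intro (h : IsIso (E.can g))
    refine ⟨(inv (E.can g)).hom.hom, ?_, ?_⟩
    · exact congrArg (fun f => Bimod.Hom.hom (Coring.Hom.hom f)) (IsIso.hom_inv_id (E.can g))
    · exact congrArg (fun f => Bimod.Hom.hom (Coring.Hom.hom f)) (IsIso.inv_hom_id (E.can g))
  · intro h
    exact Coring.isIso_of_isIso_hom (E.can g) h

variable (M : RightModule A)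

/-- The morphism `M ⊗ (A ⊗_{A^C} A) ⟶ M ⊗_{A^C} A` induced by the action of `A` on `M`. -/
noncomputable def actSweedler : M.X ⊗ (Sweedler.bimod (E.coinvIncl g)).X ⟶
    (E.induced g ((restrictionOfScalars (E.coinvIncl g)).obj M)).X :=
  relTensor.descLeft ((α_ M.X A.X A.X).inv ≫ M.act ▷ A.X ≫
    restrictedProj (E.coinvIncl g) M) (by
    have h : M.act ▷ A.X ≫ M.act = (α_ _ _ _).hom ≫ M.X ◁ μ[A.X] ≫ M.act := by
      rw [M.act_mul, Iso.hom_inv_id_assoc]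
    -- In elements, m (a b) = (m a) b for b in A^C. Hence m (a b) ⊗ a' = (m a) b ⊗ a' = m a ⊗ b a',
    -- which is the required balancing.
    have hs : M.X ◁ (A.X ◁ (E.coinvIncl g).hom ≫ μ) ≫ M.act =
        (α_ _ _ _).inv ≫ M.act ▷ _ ≫ M.X ◁ (E.coinvIncl g).hom ≫ M.act := by
      rw [← whisker_exchange_assoc, h]
      simp
    have e2 : M.X ◁ (A.X ◁ (E.coinvIncl g).hom ≫ μ) ▷ A.X ≫ (α_ _ _ _).inv ≫ M.act ▷ A.X =
        (α_ _ _ _).inv ≫ ((α_ _ _ _).inv ≫ M.act ▷ _) ▷ A.X ≫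
          (M.X ◁ (E.coinvIncl g).hom ≫ M.act) ▷ A.X := by
      rw [← comp_whiskerRight, Category.assoc, ← hs]
      simp
    have e : M.X ◁ (A.X ◁ (E.coinvIncl g).hom ≫ μ) ▷ A.X ≫ (α_ _ _ _).inv ≫ M.act ▷ A.X ≫
        restrictedProj (E.coinvIncl g) M =
          M.X ◁ ((α_ _ _ _).hom ≫ A.X ◁ ((E.coinvIncl g).hom ▷ A.X ≫ μ)) ≫ (α_ _ _ _).inv ≫
            M.act ▷ A.X ≫ restrictedProj (E.coinvIncl g) M := by
      rw [reassoc_of% e2, restrictedProj_condition]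
      simp only [MonoidalCategory.whiskerLeft_comp, Category.assoc, comp_whiskerRight]
      rw [associator_naturality_left_assoc, ← whisker_exchange_assoc, ← whisker_exchange_assoc]
      simp
    exact e)

theorem proj_actSweedler :
    M.X ◁ Sweedler.proj (E.coinvIncl g) ≫ E.actSweedler g M =
      (α_ M.X A.X A.X).inv ≫ M.act ▷ A.X ≫
        restrictedProj (E.coinvIncl g) M :=
  relTensor.proj_descLeft _ _ _ _

/-- `actSweedler` is balanced over A: it plays the role of the projection from M ⊗ (A ⊗_{A^C} A) to
M ⊗_A (A ⊗_{A^C} A) ≅ M ⊗_{A^C} A, so that the tensor product over A need not be formed. -/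
theorem actLeft_actSweedler :
    M.X ◁ (Sweedler.bimod (E.coinvIncl g)).actLeft ≫ E.actSweedler g M =
      (α_ _ _ _).inv ≫ M.act ▷ _ ≫ E.actSweedler g M := by
  rw [← cancel_epi (α_ _ _ _).hom, Iso.hom_inv_id_assoc,
    ← cancel_epi ((M.X ⊗ A.X) ◁ Sweedler.proj (E.coinvIncl g)), whisker_exchange_assoc,
    proj_actSweedler, associator_naturality_right_assoc,
    ← MonoidalCategory.whiskerLeft_comp_assoc, Sweedler.proj_actLeft]
  simp only [MonoidalCategory.whiskerLeft_comp, Category.assoc]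
  rw [proj_actSweedler, associator_inv_naturality_middle_assoc, ← comp_whiskerRight_assoc,
    M.act_mul]
  simp

theorem inr_actSweedler :
    M.X ◁ Sweedler.inr (E.coinvIncl g) ≫ E.actSweedler g M =
      restrictedProj (E.coinvIncl g) M := by
  simp only [Sweedler.inr, MonoidalCategory.whiskerLeft_comp, Category.assoc]
  rw [proj_actSweedler, associator_inv_naturality_middle_assoc, ← comp_whiskerRight_assoc,
    M.act_one]
  simp

/-- This expresses `moduleCan` as M ⊗_A can, with both sides written on M ⊗ (A ⊗_{A^C} A). It rests
on associativity of the action of A on M. -/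
theorem actSweedler_moduleCan :
    E.actSweedler g M ≫ E.moduleCan g M =
      M.X ◁ E.canHom g ≫ (α_ _ _ _).inv ≫ M.act ▷ C.X := by
  have h := E.proj_canHom g
  rw [← cancel_epi (M.X ◁ Sweedler.proj (E.coinvIncl g)), reassoc_of% (E.proj_actSweedler g M),
    proj_moduleCan, ← MonoidalCategory.whiskerLeft_comp_assoc, h, ← whisker_exchange_assoc,
    associator_inv_naturality_left_assoc, ← comp_whiskerRight]
  have h2 : M.act ▷ A.X ≫ M.act = (α_ _ _ _).hom ≫ M.X ◁ μ ≫ M.act := by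
    rw [M.act_mul, Iso.hom_inv_id_assoc]
  rw [h2]
  simp

/-- The inverse is m ⊗ c ↦ m · can⁻¹(1 ⊗ c), where the dot is `actSweedler`. It works because can⁻¹
is left A-linear and 1 ⊗ C generates A ⊗ C as a left A-module. -/
theorem isIso_moduleCan (h : IsIso (E.canHom g)) : IsIso (E.moduleCan g M) := by
  have hl : (E.bimod).actLeft ≫ inv (E.canHom g) =
      A.X ◁ inv (E.canHom g) ≫ (Sweedler.bimod (E.coinvIncl g)).actLeft := by
    have h' : (Sweedler.bimod (E.coinvIncl g)).actLeft ≫ E.canHom g =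
      A.X ◁ E.canHom g ≫ E.bimod.actLeft := (E.canBimod g).left_act_hom
    rw [IsIso.comp_inv_eq, Category.assoc, h', ← MonoidalCategory.whiskerLeft_comp_assoc,
      IsIso.inv_hom_id]
    simp
  have hu : A.X ◁ unitC ≫ E.bimod.actLeft ≫ inv (E.canHom g) = inv (E.canHom g) := by
    rw [← Category.assoc, E.unitC_actLeft, Category.id_comp]
  -- In elements, a₀ can⁻¹(1 ⊗ a₁) = can⁻¹(a₀ ⊗ a₁) = 1 ⊗ a, the last step because can sends 1 ⊗ a
  -- to the coaction of a.
  have hinr : E.coact g ≫ A.X ◁ (unitC ≫ inv (E.canHom g)) ≫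
      (Sweedler.bimod (E.coinvIncl g)).actLeft = Sweedler.inr (E.coinvIncl g) := by
    rw [MonoidalCategory.whiskerLeft_comp, Category.assoc, ← hl,
      hu, IsIso.comp_inv_eq, inr_canHom]
  refine ⟨M.X ◁ (unitC ≫ inv (E.canHom g)) ≫ E.actSweedler g M, ?_, ?_⟩
  -- Here m ⊗ a goes to m a₀ · can⁻¹(1 ⊗ a₁) = m · (a₀ can⁻¹(1 ⊗ a₁)) = m · (1 ⊗ a) = m ⊗ a.
  · rw [← cancel_epi (restrictedProj (E.coinvIncl g) M), reassoc_of% (E.proj_moduleCan g M),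
      ← whisker_exchange_assoc, ← associator_inv_naturality_right_assoc, ← actLeft_actSweedler,
      ← MonoidalCategory.whiskerLeft_comp_assoc, ← MonoidalCategory.whiskerLeft_comp_assoc,
      Category.assoc, hinr, inr_actSweedler, Category.comp_id]
  -- In the other order can cancels can⁻¹, leaving m 1 ⊗ c = m ⊗ c.
  · rw [Category.assoc, actSweedler_moduleCan, ← MonoidalCategory.whiskerLeft_comp_assoc,
      Category.assoc, IsIso.inv_hom_id, Category.comp_id, unitC,
      MonoidalCategory.whiskerLeft_comp, Category.assoc, associator_inv_naturality_middle_assoc,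
      ← comp_whiskerRight, M.act_one]
    simp

/-- The component of the mate at M has `moduleCan` as underlying morphism, by definition. Evaluating
at the regular module gives can, and conversely an inverse of can gives one for every component. -/
theorem isIso_liftComparison_iff :
    IsIso (liftComparison (EntwinedModule.forgetAdjCofree E) (E.FbarForgetAdj g)) ↔
      E.IsGalois g := by
  rw [isGalois_iff_isIso_canHom]
  constructor
  · intro h
    let t := (asIso (liftComparison (EntwinedModule.forgetAdjCofree E) (E.FbarForgetAdj g))).app
      (RightModule.regular A)
    have ht : IsIso (E.moduleCan g (RightModule.regular A)) :=
      ⟨t.inv.hom, congrArg (fun f => f.hom) t.hom_inv_id,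
        congrArg (fun f => f.hom) t.inv_hom_id⟩
    rw [canHom_eq_moduleCan]
    exact ht
  · intro h
    have (M : RightModule A) : IsIso ((liftComparison (EntwinedModule.forgetAdjCofree E)
        (E.FbarForgetAdj g)).app M) := by
      have := E.isIso_moduleCan g M h
      exact EntwinedModule.isIso_of_isIso_hom _ this
    exact NatIso.isIso_of_isIso_app _

end EntwiningStructure

end Entwine

theorem theorem5p5 {V : Type u} [Category.{v} V] [MonoidalCategory V]
    [HasEqualizers V] [HasCoequalizers V]
    [∀ W : V, PreservesColimitsOfShape WalkingParallelPair (tensorLeft W)]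
    [∀ W : V, PreservesColimitsOfShape WalkingParallelPair (tensorRight W)]
    {C : Comon V} {A : Mon V} (E : Entwine.EntwiningStructure C A) (g : Entwine.GroupLike C) :
    (E.Fbar g).IsEquivalence ↔
      E.IsGalois g ∧
        Nonempty (ComonadicLeftAdjoint (Entwine.extensionOfScalars (E.coinvIncl g))) := by
  rw [← E.isIso_liftComparison_iff g]
  exact Entwine.isEquivalence_lift_iff (Entwine.EntwinedModule.forgetAdjCofree E)
    (E.FbarForgetAdj g)
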